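/- \textbf{Setting.} Let $T>0$, $\beta>0$, let $\Omega\subset\mathbb{R}^d$ be open, convex and bounded, and let $\omega$ be open with $\overline\omega\subset\Omega$. For a compact set $K$, $C([0,T];C^k(K))$ denotes the functions on $[0,T]\times K$ that are $k$ times continuously differentiable in the second variable, with derivatives of order $\le k$ jointly continuous. Let $f\in C([0,T];C^1(\overline\Omega;\mathbb{R}^d))$, $B\in\mathbb{R}^{d\times M}$, and let $\ell\in C([0,T];C^1(\overline\Omega))$ and $g\in C^1(\overline\Omega)$ be nonnegative. For $(t_0,y_0)$ consider the problem $$(P)\quad \min_{u} \int_{t_0}^T\Big(\ell(t,y(t))+\tfrac{\beta}{2}|u(t)|^2\Big)dt+g(y(T)),\qquad y'=f(t,y)+Bu,\quad y(t_0)=y_0,$$ over $u\in L^2((t_0,T);\mathbb{R}^M)$ whose state $y$ exists on $[t_0,T]$ with values in $\overline\Omega$ (where $f$, $\ell$, $g$ are defined). For $v\in C([0,T];C^2(\overline\Omega))$ put $U_v=-\frac1\beta B^\top\nabla_y v$, and let $y(\cdot;t_0,y_0)$ be the $\overline\Omega$-valued solution, if there is one (it is then unique), of the closed-loop problem $$y'(t)=f(t,y(t))+BU_v(t,y(t)),\quad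 t\in[t_0,T],\qquad y(t_0)=y_0.$$ Put $\mathcal{G}(v)=\{(t,y(t;t_0,y_0)):(t_0,y_0)\in(0,T)\times\omega,\ t\in[t_0,T)\}$ and $\mathcal{R}(v)=\{y:\exists t\in(0,T),\ (t,y)\in\mathcal{G}(v)\}$. Let $\mathcal{D}$ be the set of $v\in C([0,T];C^2(\overline\Omega))$ for which the closed-loop problem is solvable for all $(t_0,y_0)\in[0,T]\times\omega$ and $\overline{\mathcal{R}(v)}\subset\Omega$. At every $(t_0,y_0)$ from which the closed-loop problem is solvable, put $$\mathcal{V}(t_0,y_0,v)=\int_{t_0}^T\Big(\ell(t,y(t))+\tfrac\beta2|U_v(t,y(t))|^2\Big)dt+g(y(T)),\qquad y=y(\cdot;t_0,y_0),$$ and let $D_v\mathcal{V}(t_0,y_0,v)\cdot\phi=\frac{d}{ds}\mathcal{V}(t_0,y_0,v+s\phi)\big|_{s=0}$. \textbf{Proposition.} Let $v^*\in\mathcal{D}$ satisfy the necessary condition $$\int_\omega\int_0^T D_v\mathcal{V}(t_0,y_0,v^*)\cdot\phi\,dt_0\,dy_0=0\qquad\text{for all }\phi\in C([0,T];C^2(\overline\Omega)).$$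 Then: (1) $\mathcal{G}(v^*)$ is open, and $W=\mathcal{V}(\cdot,\cdot,v^*)$ is $C^1$ in $\mathcal{G}(v^*)$ and satisfies there $$\partial_t W(t,y)+\ell(t,y)+\min_{u\in\mathbb{R}^M}\Big\{\nabla_yW(t,y)^\top\big(f(t,y)+Bu\big)+\tfrac\beta2|u|^2\Big\}=0.$$ (2) $W$ is continuous on $\overline{\mathcal{G}(v^*)}$, and $W(T,y_0)=g(y_0)$ for all $y_0$ with $(T,y_0)\in\overline{\mathcal{G}(v^*)}$. (3) Let $(t_0,y_0)\in\mathcal{G}(v^*)$. If $(P)$ with initial datum $(t_0,y_0)$ has an optimal trajectory $y^*\in C^1([t_0,T];\mathbb{R}^d)$ with $(t,y^*(t))\in\mathcal{G}(v^*)$ for all $t\in[t_0,T)$, then $U_{v^*}$ is an optimal feedback for $(P)$ at $(t_0,y_0)$: the closed-loop problem with $v=v^*$ has a solution $y$ from $(t_0,y_0)$, and the control $t\mapsto U_{v^*}(t,y(t))$ with its state $y$ is optimal for $(P)$. -/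

import Mathlib

open Set MeasureTheory Topology

noncomputable section

namespace FeedbackLearning

/-- The space `C([0,T]; C^k(K))`: `v t` is `k` times continuously differentiable on `K` for every
`t ∈ [0,T]`, and the spatial derivatives of order `≤ k` are jointly continuous on `[0,T] × K`.
(For compact `K` this says that `t ↦ v t` is a continuous map from `[0,T]` into `C^k(K)`.) -/
def MemCk {E F : Type*} [NormedAddCommGroup E] [NormedSpace ℝ E]
    [NormedAddCommGroup F] [NormedSpace ℝ F]
    (T : ℝ) (K : Set E) (k : ℕ) (v : ℝ → E → F) : Prop :=
  (∀ t ∈ Icc (0 : ℝ) T, ContDiffOn ℝ k (v t) K) ∧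
    ∀ j : ℕ, j ≤ k →
      ContinuousOn (fun p : ℝ × E => iteratedFDerivWithin ℝ j (v p.1) K p.2) (Icc (0 : ℝ) T ×ˢ K)

/-- The state space `ℝ^d` with the Euclidean norm. -/
abbrev State (d : ℕ) : Type := EuclideanSpace ℝ (Fin d)

/-- The control space `ℝ^M` with the Euclidean norm. -/
abbrev Ctrl (M : ℕ) : Type := EuclideanSpace ℝ (Fin M)

/-- The data of the control problem
`min_u ∫_{t₀}^T (ℓ(t,y) + β/2 |u|²) dt + g(y(T))`, `y' = f(t,y) + B u`, `y(t₀) = y₀`,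
and the set `ω` of initial states, with the standing assumptions on them.
A real `d × M` matrix is the same thing as a linear map `ℝ^M → ℝ^d`. -/
structure Problem (d M : ℕ) where
  /-- the final time -/
  T : ℝ
  T_pos : 0 < T
  /-- the state domain -/
  Ω : Set (State d)
  isOpen_Ω : IsOpen Ω
  convex_Ω : Convex ℝ Ω
  bounded_Ω : Bornology.IsBounded Ω
  /-- the set of initial states -/
  ω : Set (State d)
  isOpen_ω : IsOpen ω
  closure_ω_subset : closure ω ⊆ Ω
  /-- the control cost -/
  β : ℝ
  β_pos : 0 < β
  /-- the drift -/
  f : ℝ → State d → State d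
  f_mem : MemCk T (closure Ω) 1 f
  /-- the control operator -/
  B : Ctrl M →L[ℝ] State d
  /-- the running cost -/
  ℓ : ℝ → State d → ℝ
  ℓ_mem : MemCk T (closure Ω) 1 ℓ
  ℓ_nonneg : ∀ t ∈ Icc (0 : ℝ) T, ∀ y ∈ closure Ω, 0 ≤ ℓ t y
  /-- the terminal cost -/
  g : State d → ℝ
  g_contDiffOn : ContDiffOn ℝ 1 g (closure Ω)
  g_nonneg : ∀ y ∈ closure Ω, 0 ≤ g y

namespace Problem

variable {d M : ℕ} (P : Problem d M)

/-- `y` is a solution on `[t₀,T]`, with values in the closure of `Ω`, of `y' = f(t,y) + B u`,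
`y(t₀) = y₀`, with control `u ∈ L²((t₀,T); ℝ^M)`. -/
def IsAdmissible (t₀ : ℝ) (y₀ : State d) (u : ℝ → Ctrl M) (y : ℝ → State d) : Prop :=
  MemLp u 2 (volume.restrict (Ioo t₀ P.T)) ∧
  ContinuousOn y (Icc t₀ P.T) ∧
  (∀ t ∈ Icc t₀ P.T, y t ∈ closure P.Ω) ∧
  ∀ t ∈ Icc t₀ P.T, y t = y₀ + ∫ s in t₀..t, (P.f s (y s) + P.B (u s))

/-- The cost functional `J`, for a control `u` and the corresponding state `y`. -/
def cost (t₀ : ℝ) (u : ℝ → Ctrl M) (y : ℝ → State d) : ℝ :=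
  (∫ t in t₀..P.T, (P.ℓ t (y t) + P.β / 2 * ‖u t‖ ^ 2)) + P.g (y P.T)

/-- `u` is an optimal control with optimal trajectory `y` for the initial datum `(t₀,y₀)`. -/
def IsOptimal (t₀ : ℝ) (y₀ : State d) (u : ℝ → Ctrl M) (y : ℝ → State d) : Prop :=
  P.IsAdmissible t₀ y₀ u y ∧
    ∀ u' y', P.IsAdmissible t₀ y₀ u' y' → P.cost t₀ u y ≤ P.cost t₀ u' y'

/-- `y` solves on `[t₀,T]` the closed-loop problem `y' = f(t,y) + B K(t,y)`, `y(t₀) = y₀`, for the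
feedback law `K`. The law and `f` matter on `[0,T] × closure Ω` only, so `y` takes values in
`closure Ω`. -/
def IsClosedLoop (K : ℝ → State d → Ctrl M) (t₀ : ℝ) (y₀ : State d) (y : ℝ → State d) : Prop :=
  y t₀ = y₀ ∧ ∀ t ∈ Icc t₀ P.T, y t ∈ closure P.Ω ∧
    HasDerivWithinAt y (P.f t (y t) + P.B (K t (y t))) (Icc t₀ P.T) t

/-- The feedback law `K` is optimal for the initial datum `(t₀,y₀)`: the closed-loop problem is
solvable, and its solution, with the control that the feedback generates, is optimal. -/
def IsOptimalFeedbackAt (K : ℝ → State d → Ctrl M) (t₀ : ℝ) (y₀ : State d) : Prop :=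
  (∃ y, P.IsClosedLoop K t₀ y₀ y) ∧
    ∀ y, P.IsClosedLoop K t₀ y₀ y → P.IsOptimal t₀ y₀ (fun t => K t (y t)) y

/-- The feedback `U_v(t,y) = -(1/β) Bᵀ ∇_y v(t,y)`, for `(t,y) ∈ [0,T] × closure Ω`. -/
def U (v : ℝ → State d → ℝ) (t : ℝ) (y : State d) : Ctrl M :=
  -(1 / P.β) • (ContinuousLinearMap.adjoint P.B) (gradientWithin (v t) (closure P.Ω) y)

open Classical in
/-- The solution `y(·; t₀,y₀)` on `[t₀,T]` of the closed-loop problem with feedback `U_v`.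
It is only used where a solution exists; for `v` in `C([0,T]; C²)` it is then unique. -/
def Φ (v : ℝ → State d → ℝ) (t₀ : ℝ) (y₀ : State d) : ℝ → State d :=
  if h : ∃ y, P.IsClosedLoop (P.U v) t₀ y₀ y then h.choose else fun _ => y₀

/-- The set `𝒢(v)` reached by the closed-loop trajectories. -/
def G (v : ℝ → State d → ℝ) : Set (ℝ × State d) :=
  {p | ∃ t₀ ∈ Ioo (0 : ℝ) P.T, ∃ y₀ ∈ P.ω, ∃ t ∈ Ico t₀ P.T, p = (t, P.Φ v t₀ y₀ t)}

/-- The set `ℛ(v)` of the states that occur in `𝒢(v)`. -/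
def R (v : ℝ → State d → ℝ) : Set (State d) :=
  {y | ∃ t ∈ Ioo (0 : ℝ) P.T, (t, y) ∈ P.G v}

/-- The set `𝒟`. -/
def D : Set (ℝ → State d → ℝ) :=
  {v | MemCk P.T (closure P.Ω) 2 v ∧
    (∀ t₀ ∈ Icc (0 : ℝ) P.T, ∀ y₀ ∈ P.ω, ∃ y, P.IsClosedLoop (P.U v) t₀ y₀ y) ∧
    closure (P.R v) ⊆ P.Ω}

/-- The cost `𝒱(t₀,y₀,v)` of the feedback `U_v`. It is given by the same formula at every `(t₀,y₀)`
from which the closed-loop problem is solvable, in particular on the closure of `𝒢(v)`. -/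
def 𝒱 (v : ℝ → State d → ℝ) (t₀ : ℝ) (y₀ : State d) : ℝ :=
  (∫ t in t₀..P.T,
      (P.ℓ t (P.Φ v t₀ y₀ t) + P.β / 2 * ‖P.U v t (P.Φ v t₀ y₀ t)‖ ^ 2)) +
    P.g (P.Φ v t₀ y₀ P.T)

/-- The derivative `D_v𝒱(t₀,y₀,v)·φ` of `𝒱` with respect to `v` in the direction `φ`. -/
def dv𝒱 (v φ : ℝ → State d → ℝ) (t₀ : ℝ) (y₀ : State d) : ℝ :=
  deriv (fun s : ℝ => P.𝒱 (v + s • φ) t₀ y₀) 0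

/-- The first-order necessary condition. The directions `φ` are those of the space
`C([0,T]; C²(closure Ω))`, on (an open subset of) which `𝒱` is defined as a function of `v`; to ask
for the same identity for the continuous extension of `D_v𝒱` to `C([0,T]; C¹(closure Ω))` is to
ask for no less. -/
def NecessaryCondition (v : ℝ → State d → ℝ) : Prop :=
  ∀ φ : ℝ → State d → ℝ, MemCk P.T (closure P.Ω) 2 φ →
    (∫ y₀ in P.ω, (∫ t₀ in (0 : ℝ)..P.T, P.dv𝒱 v φ t₀ y₀)) = 0

/-- `W` solves the Hamilton-Jacobi-Bellman equation
`∂W/∂t + ℓ + min_u {∇_y W · (f + B u) + β/2 |u|²} = 0` classically in the open set `S`. -/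
def SolvesHJBOn (W : ℝ → State d → ℝ) (S : Set (ℝ × State d)) : Prop :=
  ContDiffOn ℝ 1 (fun p : ℝ × State d => W p.1 p.2) S ∧
  ∀ t y, (t, y) ∈ S → ∃ m : ℝ,
    IsLeast (range fun u : Ctrl M =>
      inner ℝ (gradient (W t) y) (P.f t y + P.B u) + P.β / 2 * ‖u‖ ^ 2) m ∧
    deriv (fun s => W s y) t + P.ℓ t y + m = 0

end Problem

end FeedbackLearning

end

/-!
The closed-loop vector field `f + B U_v`, the running cost and the terminal cost are multiplied by a
smooth function `χ` of the state that equals `1` near the compact set `closure (ℛ v)` and has its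
support in `Ω`, and are continued by constants in time. The result is a bounded problem on the whole
space, with a flow `X` that is defined for all times. Trajectories that start in `closure (𝒢 v)`
stay in `closure (ℛ v)`, so there they are the closed-loop trajectories, and `𝒱 v` agrees with the
cost `W` of the flow `X` (`IsCutFlow.closure_G_subset_stays`, `IsCutFlow.𝒱_eq_of_mem_stays`).

*Regularity.* A field that is continuous, and of class `C¹` in the state, has a flow of class `C¹`
in the initial datum (`IsFlow.exists_hasFDerivAt`): the derivative in the state solves the equation of
first variation, and the derivative in the initial time follows because the terminal state is
constant along trajectories. Hence `W` is `C¹` (`contDiff_value`), and differentiating it along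
trajectories gives the transport equation `∂ₜW + ∇W · (f + B U_v) + ℓ + β/2 |U_v|² = 0`
(`fderiv_value`). Openness of `𝒢 v` comes from running the flow backwards into the open set `ω`
(`IsCutFlow.isOpen_G`).

*Use of the necessary condition.* By the transport equation, the cost of any curve `y` is
`W(t₀,y₀)` plus the integral of `∇W · (y' - f - B U_v)` (`integral_add_eq_value_add`). Applied to
the trajectories for `v + sφ`, this gives `D_v𝒱(t₀,y₀,v)·φ` as the integral of `(Bᵀ∇W + β U_v) · U_φ`
along the trajectory from `(t₀,y₀)` (`IsCutFlow.hasDerivAt_𝒱`). As `U_v = -Bᵀ∇v/β`, the choice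
`φ = W - v`, which is admissible after mollification (`exists_memCk_two_approx`), turns the
necessary condition into the vanishing of the integral of `|Bᵀ∇(W - v)|²` over all trajectories; so
`Bᵀ∇W = -β U_v` on `𝒢 v` (`IsCutFlow.residual_eq_zero`).

*Conclusion.* Then `U_v` is the minimiser in the Hamilton-Jacobi-Bellman equation, and the transport
equation becomes that equation. Completing the square shows that a trajectory in `𝒢 v` with control
`u` has the cost `W(t₀,y₀)` plus the integral of `β/2 |u - U_v|²`, so that an optimal trajectory in
`𝒢 v` costs no less than the closed loop (`IsCutFlow.cutValue_le_cost`).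
-/

namespace FeedbackLearning

open Filter Metric
open scoped NNReal

/-! ### Ordinary differential equations with a Lipschitz right-hand side -/

section Ode

variable {E : Type*} [NormedAddCommGroup E] [NormedSpace ℝ E]

theorem gronwallBound_le {δ K ε x : ℝ} (hK : 0 ≤ K) (hε : 0 ≤ ε) :
    gronwallBound δ K ε x ≤ (δ + ε * x) * Real.exp (K * x) := by
  rcases hK.eq_or_lt with rfl | hK
  · simp [gronwallBound_K0]
  · rw [gronwallBound_of_K_ne_0 hK.ne']
    have h1 : 1 - K * x ≤ Real.exp (-(K * x)) := by
      have := Real.add_one_le_exp (-(K * x)); linarith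
    have h2 : (1 - K * x) * Real.exp (K * x) ≤ 1 := by
      have := mul_le_mul_of_nonneg_right h1 (Real.exp_pos (K * x)).le
      rwa [← Real.exp_add, neg_add_cancel, Real.exp_zero] at this
    have h3 : ε / K * (Real.exp (K * x) - 1) ≤ ε / K * (K * x * Real.exp (K * x)) := by
      apply mul_le_mul_of_nonneg_left _ (by positivity)
      linarith
    have h4 : ε / K * (K * x * Real.exp (K * x)) = ε * x * Real.exp (K * x) := by
      field_simp
    linarith

theorem norm_sub_le_of_approx_right {F : ℝ → E → E} {K : ℝ≥0} (hF : ∀ t, LipschitzWith K (F t))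
    {y z z' : ℝ → E} (hy : IsIntegralCurve y F) (hz : ∀ t, HasDerivAt z (z' t) t)
    {s t ε : ℝ} (hst : s ≤ t) (hε0 : 0 ≤ ε) (hε : ∀ τ ∈ Icc s t, ‖z' τ - F τ (z τ)‖ ≤ ε) :
    ‖y t - z t‖ ≤ (‖y s - z s‖ + ε * (t - s)) * Real.exp (K * (t - s)) := by
  have := dist_le_of_approx_trajectories_ODE (v := F) (K := K) (f := y) (g := z)
    (f' := fun t => F t (y t)) (g' := z') (a := s) (b := t) (εf := 0) (εg := ε)
    (δ := ‖y s - z s‖) hF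
    (fun τ _ => (hy τ).continuousAt.continuousWithinAt) (fun τ _ => (hy τ).hasDerivWithinAt)
    (fun τ _ => by simp) (fun τ _ => (hz τ).continuousAt.continuousWithinAt)
    (fun τ _ => (hz τ).hasDerivWithinAt)
    (fun τ hτ => by rw [dist_eq_norm]; exact hε τ ⟨hτ.1, hτ.2.le⟩)
    (by rw [dist_eq_norm]) t ⟨hst, le_rfl⟩
  rw [dist_eq_norm, zero_add] at this
  exact this.trans (gronwallBound_le K.2 hε0)

theorem IsIntegralCurve.reflect {F : ℝ → E → E} {y : ℝ → E} (hy : IsIntegralCurve y F) :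
    IsIntegralCurve (fun t => y (-t)) (fun t x => -F (-t) x) := by
  intro t
  have := (hy (-t)).scomp t (hasDerivAt_neg t)
  simpa using! this

/-- Grönwall's inequality for an exact solution `y` and an approximate solution `z`, in both
directions of time. -/
theorem norm_sub_le_of_approx {F : ℝ → E → E} {K : ℝ≥0} (hF : ∀ t, LipschitzWith K (F t))
    {y z z' : ℝ → E} (hy : IsIntegralCurve y F) (hz : ∀ t, HasDerivAt z (z' t) t)
    {s t ε : ℝ} (hε0 : 0 ≤ ε) (hε : ∀ τ ∈ uIcc s t, ‖z' τ - F τ (z τ)‖ ≤ ε) :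
    ‖y t - z t‖ ≤ (‖y s - z s‖ + ε * |t - s|) * Real.exp (K * |t - s|) := by
  rcases le_total s t with h | h
  · rw [abs_of_nonneg (sub_nonneg.2 h)]
    rw [uIcc_of_le h] at hε
    exact norm_sub_le_of_approx_right hF hy hz h hε0 hε
  · rw [abs_of_nonpos (sub_nonpos.2 h)]
    rw [uIcc_of_ge h] at hε
    have := norm_sub_le_of_approx_right (F := fun t x => -F (-t) x) (K := K)
      (fun t => (hF (-t)).neg) (IsIntegralCurve.reflect hy)
      (z := fun t => z (-t)) (z' := fun t => -z' (-t))
      (fun t => by simpa using! (hz (-t)).scomp t (hasDerivAt_neg t)) (s := -s) (t := -t)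
      (neg_le_neg h) hε0 (fun τ hτ => by
        rw [← neg_sub', norm_neg]
        exact hε _ ⟨by linarith [hτ.2], by linarith [hτ.1]⟩)
    simp only [neg_neg] at this
    convert this using 3 <;> ring_nf

theorem norm_sub_le_of_isIntegralCurve {F : ℝ → E → E} {K : ℝ≥0}
    (hF : ∀ t, LipschitzWith K (F t)) {y z : ℝ → E} (hy : IsIntegralCurve y F)
    (hz : IsIntegralCurve z F) (s t : ℝ) :
    ‖y t - z t‖ ≤ ‖y s - z s‖ * Real.exp (K * |t - s|) := by
  simpa using norm_sub_le_of_approx hF hy hz (s := s) (t := t) le_rfl (fun τ _ => by simp)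

theorem eq_of_isIntegralCurve {F : ℝ → E → E} {K : ℝ≥0}
    (hF : ∀ t, LipschitzWith K (F t)) {y z : ℝ → E} (hy : IsIntegralCurve y F)
    (hz : IsIntegralCurve z F) {s : ℝ} (h : y s = z s) : y = z := by
  ext t
  have := norm_sub_le_of_isIntegralCurve hF hy hz s t
  rw [h, sub_self, norm_zero, zero_mul] at this
  exact sub_eq_zero.1 (norm_le_zero_iff.1 this)

theorem IsIntegralCurveOn.glue {F : ℝ → E → E} {y z : ℝ → E} {a b c : ℝ} (hab : a ≤ b)
    (hbc : b ≤ c) (hy : IsIntegralCurveOn y F (Icc a b)) (hz : IsIntegralCurveOn z F (Icc b c))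
    (h : y b = z b) : IsIntegralCurveOn (fun t => if t ≤ b then y t else z t) F (Icc a c) := by
  set w : ℝ → E := fun t => if t ≤ b then y t else z t with hw
  have wy : ∀ t ∈ Icc a b, w t = y t := fun t ht => by simp [hw, ht.2]
  have wz : ∀ t ∈ Icc b c, w t = z t := fun t ht => by
    rcases ht.1.eq_or_lt with rfl | h'
    · simp [hw, h]
    · simp [hw, not_le.2 h']
  have h1 : ∀ t, HasDerivWithinAt w (F t (w t)) (Icc a b) t := fun t => by
    by_cases ht : t ∈ Icc a b
    · rw [wy t ht]; exact (hy t ht).congr wy (wy t ht)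
    · exact HasFDerivWithinAt.of_notMem_closure (by rwa [isClosed_Icc.closure_eq])
  have h2 : ∀ t, HasDerivWithinAt w (F t (w t)) (Icc b c) t := fun t => by
    by_cases ht : t ∈ Icc b c
    · rw [wz t ht]; exact (hz t ht).congr wz (wz t ht)
    · exact HasFDerivWithinAt.of_notMem_closure (by rwa [isClosed_Icc.closure_eq])
  intro t _
  rw [← Icc_union_Icc_eq_Icc hab hbc]
  exact (h1 t).union (h2 t)

variable [CompleteSpace E]

/-- Local solutions of an ODE with a globally Lipschitz right-hand side exist on time intervals
whose length depends only on the Lipschitz constant. -/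
theorem exists_isIntegralCurveOn_short {F : ℝ → E → E} {K : ℝ≥0}
    (hFc : Continuous (Function.uncurry F)) (hF : ∀ t, LipschitzWith K (F t)) {τ : ℝ}
    (hτ0 : 0 ≤ τ) (hτ : K * τ ≤ 1 / 2) (s : ℝ) (x : E) :
    ∃ y : ℝ → E, y s = x ∧ IsIntegralCurveOn y F (Icc (s - τ) (s + τ)) := by
  obtain ⟨C, hC⟩ := (isCompact_Icc (a := s - τ) (b := s + τ)).exists_bound_of_continuousOn
    (f := fun t => F t x) (by fun_prop)
  have hs : s ∈ Icc (s - τ) (s + τ) := ⟨by linarith, by linarith⟩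
  have hC0 : 0 ≤ C := (norm_nonneg _).trans (hC s hs)
  lift C to ℝ≥0 using hC0
  lift τ to ℝ≥0 using hτ0
  have hP : IsPicardLindelof F (tmin := s - τ) (tmax := s + τ) ⟨s, hs⟩ x (2 * C * τ) 0
      (C + K * (2 * C * τ)) K := by
    refine ⟨fun t _ => (hF t).lipschitzOnWith, fun x _ => by fun_prop, fun t ht y hy => ?_, ?_⟩
    · have h1 := (hF t).norm_sub_le y x
      have h2 : ‖F t y‖ ≤ ‖F t x‖ + ‖F t y - F t x‖ := by
        simpa using norm_add_le (F t x) (F t y - F t x)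
      rw [mem_closedBall, dist_eq_norm] at hy
      have h3 := mul_le_mul_of_nonneg_left hy K.2
      have := hC t ht
      push_cast at h3 ⊢
      simp only [NNReal.val_eq_coe] at h3
      linarith
    · push_cast
      simp only [add_sub_cancel_left, sub_sub_cancel, max_self, sub_zero]
      have : (C : ℝ) * τ * (K * τ) ≤ C * τ * (1 / 2) := by gcongr
      nlinarith
  obtain ⟨y, h1, h2⟩ := hP.exists_eq_forall_mem_Icc_hasDerivWithinAt₀
  exact ⟨y, h1, h2⟩

theorem exists_isIntegralCurveOn_long {F : ℝ → E → E} {K : ℝ≥0}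
    (hFc : Continuous (Function.uncurry F)) (hF : ∀ t, LipschitzWith K (F t)) {τ : ℝ}
    (hτ0 : 0 ≤ τ) (hτ : K * τ ≤ 1 / 2) (s : ℝ) (x : E) (n : ℕ) :
    ∃ y : ℝ → E, y s = x ∧ IsIntegralCurveOn y F (Icc (s - n * τ) (s + n * τ)) := by
  induction n with
  | zero =>
    obtain ⟨y, hy, hy'⟩ := exists_isIntegralCurveOn_short hFc hF hτ0 hτ s x
    exact ⟨y, hy, hy'.mono (Icc_subset_Icc (by simp; linarith) (by simp; linarith))⟩
  | succ n ih =>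
    obtain ⟨y, hy, hy'⟩ := ih
    obtain ⟨z, hz, hz'⟩ := exists_isIntegralCurveOn_short hFc hF hτ0 hτ (s + n * τ) (y (s + n * τ))
    obtain ⟨w, hw, hw'⟩ := exists_isIntegralCurveOn_short hFc hF hτ0 hτ (s - n * τ) (y (s - n * τ))
    have hn : 0 ≤ n * τ := by positivity
    have g1 := IsIntegralCurveOn.glue (b := s + n * τ) (c := s + (n + 1 : ℕ) * τ) (by linarith)
      (by push_cast; linarith) hy'
      (hz'.mono (Icc_subset_Icc (by linarith) (by push_cast; linarith))) hz.symm
    have g2 := IsIntegralCurveOn.glue (a := s - (n + 1 : ℕ) * τ) (b := s - n * τ)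
      (by push_cast; linarith) (by push_cast; linarith)
      (hw'.mono (Icc_subset_Icc (by push_cast; linarith) (by linarith))) g1 (by
        rw [if_pos (by linarith), hw])
    refine ⟨_, ?_, g2⟩
    split_ifs with h1 h2
    · have : s - n * τ = s := by linarith
      rw [this] at hw
      rw [hw, hy]
    · exact hy
    · exact absurd (by linarith) h2

/-- Global existence for an ODE whose right-hand side is continuous and globally Lipschitz in the
state. -/
theorem exists_isIntegralCurve {F : ℝ → E → E} {K : ℝ≥0}
    (hFc : Continuous (Function.uncurry F)) (hF : ∀ t, LipschitzWith K (F t)) (s : ℝ) (x : E) :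
    ∃ y : ℝ → E, y s = x ∧ IsIntegralCurve y F := by
  obtain ⟨τ, hτ0, hτ⟩ : ∃ τ : ℝ, 0 < τ ∧ K * τ ≤ 1 / 2 := by
    refine ⟨1 / (2 * (K + 1)), by positivity, ?_⟩
    rw [mul_one_div, div_le_div_iff₀ (by positivity) (by norm_num)]
    linarith
  -- solutions on growing intervals agree by uniqueness, so they patch together
  choose y hy hy' using exists_isIntegralCurveOn_long hFc hF hτ0.le hτ s x
  have key : ∀ n m : ℕ, 0 < n → n ≤ m → ∀ t ∈ Icc (s - n * τ) (s + n * τ), y n t = y m t := by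
    intro n m hn hnm
    have hn' : 0 < n * τ := by positivity
    have hnm' : (n : ℝ) * τ ≤ m * τ := by gcongr
    have hm := (hy' m).mono (Icc_subset_Icc (a₁ := s - n * τ) (b₁ := s + n * τ)
      (by linarith) (by linarith))
    exact ODE_solution_unique_of_mem_Icc (v := F) (s := fun _ => univ)
      (fun t _ => (hF t).lipschitzOnWith)
      (t₀ := s) ⟨by linarith, by linarith⟩ (hy' n).continuousOn
      (fun t ht => (hy' n t (Ioo_subset_Icc_self ht)).hasDerivAt (Icc_mem_nhds ht.1 ht.2))
      (fun _ _ => trivial) hm.continuousOn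
      (fun t ht => (hm t (Ioo_subset_Icc_self ht)).hasDerivAt (Icc_mem_nhds ht.1 ht.2))
      (fun _ _ => trivial) ((hy n).trans (hy m).symm)
  have hN : ∀ t, ∃ n : ℕ, 0 < n ∧ t ∈ Ioo (s - n * τ) (s + n * τ) := fun t => by
    obtain ⟨n, hn⟩ := exists_nat_gt (|t - s| / τ)
    have hn' : |t - s| < n * τ := (div_lt_iff₀ hτ0).1 hn
    have := abs_lt.1 hn'
    refine ⟨n, ?_, by linarith, by linarith⟩
    rcases Nat.eq_zero_or_pos n with rfl | h
    · simp at hn'; exact absurd hn' (not_lt.2 (abs_nonneg _))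
    · exact h
  choose N hN0 hN using hN
  have key2 : ∀ (t : ℝ) (n : ℕ), 0 < n → t ∈ Icc (s - n * τ) (s + n * τ) → y (N t) t = y n t := by
    intro t n hn ht
    rcases le_total (N t) n with h | h
    · exact key _ _ (hN0 t) h t (Ioo_subset_Icc_self (hN t))
    · exact (key _ _ hn h t ht).symm
  refine ⟨fun t => y (N t) t, hy _, fun t => ?_⟩
  have h1 := (hy' (N t) t (Ioo_subset_Icc_self (hN t))).hasDerivAt
    (Icc_mem_nhds (hN t).1 (hN t).2)
  refine h1.congr_of_eventuallyEq ?_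
  filter_upwards [Ioo_mem_nhds (hN t).1 (hN t).2] with t' ht'
  exact key2 t' _ (hN0 t) (Ioo_subset_Icc_self ht')

end Ode

/-! ### Flows of class `C¹` -/

section Flow

variable {E E' : Type*} [NormedAddCommGroup E] [NormedSpace ℝ E]
  [NormedAddCommGroup E'] [NormedSpace ℝ E']

/-- `F : ℝ → E → E'` is jointly continuous and differentiable in the second variable, with a
derivative `F'` that is jointly continuous and bounded by `K`. -/
structure IsC1Bounded (F : ℝ → E → E') (F' : ℝ × E → E →L[ℝ] E') (K : ℝ≥0) : Prop where
  continuous : Continuous (Function.uncurry F)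
  hasFDerivAt : ∀ t x, HasFDerivAt (F t) (F' (t, x)) x
  continuous_deriv : Continuous F'
  bound : ∀ p, ‖F' p‖ ≤ K

theorem IsC1Bounded.lipschitzWith {F : ℝ → E → E'} {F' : ℝ × E → E →L[ℝ] E'} {K : ℝ≥0}
    (h : IsC1Bounded F F' K) (t : ℝ) : LipschitzWith K (F t) :=
  lipschitzWith_of_nnnorm_fderiv_le (𝕜 := ℝ) (fun x => (h.hasFDerivAt t x).differentiableAt)
    fun x => by rw [(h.hasFDerivAt t x).fderiv]; exact h.bound _

/-- First-order Taylor expansion, uniform along a compact piece of a curve. -/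
theorem IsC1Bounded.exists_taylor {F : ℝ → E → E'} {F' : ℝ × E → E →L[ℝ] E'} {K : ℝ≥0}
    (h : IsC1Bounded F F' K) {y : ℝ → E} (hy : Continuous y) {S : Set ℝ} (hS : IsCompact S)
    {ε : ℝ} (hε : 0 < ε) :
    ∃ δ > 0, ∀ τ ∈ S, ∀ w, ‖w - y τ‖ < δ →
      ‖F τ w - F τ (y τ) - F' (τ, y τ) (w - y τ)‖ ≤ ε * ‖w - y τ‖ := by
  have h1 : ∀ᶠ k : E in 𝓝 0, ∀ τ ∈ S, ‖F' (τ, y τ + k) - F' (τ, y τ)‖ < ε := by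
    refine hS.eventually_forall_of_forall_eventually fun τ _ => ?_
    have hc : Continuous fun z : E × ℝ => ‖F' (z.2, y z.2 + z.1) - F' (z.2, y z.2)‖ := by
      have := h.continuous_deriv
      fun_prop
    exact hc.continuousAt.eventually_lt continuousAt_const (by simpa using hε)
  obtain ⟨δ, hδ, hball⟩ := Metric.eventually_nhds_iff_ball.1 h1
  refine ⟨δ, hδ, fun τ hτ w hw => ?_⟩
  refine (convex_ball (y τ) δ).norm_image_sub_le_of_norm_hasFDerivWithin_le' (𝕜 := ℝ)
    (f' := fun z => F' (τ, z)) (fun z _ => (h.hasFDerivAt τ z).hasFDerivWithinAt)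
    (fun z hz => ?_) (mem_ball_self hδ) (by simpa [dist_eq_norm] using hw)
  have := hball (z - y τ) (by simpa [dist_eq_norm] using hz) τ hτ
  simpa using this.le

/-- `X s x` is the solution of `y' = F(t,y)`, `y(s) = x`, defined for all times. -/
structure IsFlow (F : ℝ → E → E) (X : ℝ → E → ℝ → E) : Prop where
  init : ∀ s x, X s x s = x
  curve : ∀ s x, IsIntegralCurve (X s x) F

theorem exists_isFlow [CompleteSpace E] {F : ℝ → E → E} {K : ℝ≥0}
    (hFc : Continuous (Function.uncurry F)) (hF : ∀ t, LipschitzWith K (F t)) :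
    ∃ X, IsFlow F X := by
  choose X hX hX' using exists_isIntegralCurve hFc hF
  exact ⟨X, hX, hX'⟩

namespace IsFlow

variable {F : ℝ → E → E} {X : ℝ → E → ℝ → E} {K : ℝ≥0}

theorem eq_of_curve (hX : IsFlow F X) (hF : ∀ t, LipschitzWith K (F t)) {y : ℝ → E}
    (hy : IsIntegralCurve y F) (s : ℝ) : X s (y s) = y :=
  eq_of_isIntegralCurve hF (hX.curve _ _) hy (s := s) (hX.init _ _)

theorem restart (hX : IsFlow F X) (hF : ∀ t, LipschitzWith K (F t)) (s t : ℝ) (x : E) :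
    X t (X s x t) = X s x :=
  hX.eq_of_curve hF (hX.curve s x) t

theorem continuous (hX : IsFlow F X) (hF : ∀ t, LipschitzWith K (F t)) :
    Continuous fun p : (ℝ × E) × ℝ => X p.1.1 p.1.2 p.2 := by
  rw [continuous_iff_continuousAt]
  rintro ⟨⟨s, x⟩, t⟩
  have hc := (hX.curve s x).continuous
  rw [ContinuousAt, tendsto_iff_norm_sub_tendsto_zero]
  -- two solutions are compared at the initial time of the moving one
  have hb : ∀ p : (ℝ × E) × ℝ, ‖X p.1.1 p.1.2 p.2 - X s x t‖ ≤
      ‖p.1.2 - X s x p.1.1‖ * Real.exp (K * |p.2 - p.1.1|) + ‖X s x p.2 - X s x t‖ := fun p => by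
    have h1 := norm_sub_le_of_isIntegralCurve hF (hX.curve p.1.1 p.1.2) (hX.curve s x) p.1.1 p.2
    rw [hX.init] at h1
    have h2 := norm_sub_le_norm_sub_add_norm_sub (X p.1.1 p.1.2 p.2) (X s x p.2) (X s x t)
    linarith
  refine squeeze_zero (fun _ => norm_nonneg _) hb ?_
  have : Continuous fun p : (ℝ × E) × ℝ =>
      ‖p.1.2 - X s x p.1.1‖ * Real.exp (K * |p.2 - p.1.1|) + ‖X s x p.2 - X s x t‖ := by
    fun_prop
  refine (this.tendsto' _ _ ?_)
  simp [hX.init]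

variable {F' : ℝ × E → E →L[ℝ] E}

/-- The flow is differentiable in the initial state; its derivative solves the equation of first
variation. -/
theorem hasFDerivAt_state (hX : IsFlow F X) (hF : IsC1Bounded F F' K) {s : ℝ} {x : E}
    {R : ℝ → E →L[ℝ] E} (hR0 : R s = ContinuousLinearMap.id ℝ E)
    (hR : IsIntegralCurve R fun t A => (F' (t, X s x t)).comp A) (t : ℝ) :
    HasFDerivAt (fun z => X s z t) (R t) x := by
  have hL := hF.lipschitzWith
  have hc := (hX.curve s x).continuous
  set c : ℝ := Real.exp (K * |t - s|) with hcdef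
  have hc0 : 0 < c := Real.exp_pos _
  refine HasFDerivAt.of_isLittleO (Asymptotics.isLittleO_iff.2 fun ε hε => ?_)
  set η : ℝ := ε / (c * (|t - s| + 1) * c) with hη
  have hη0 : 0 < η := by positivity
  obtain ⟨δ, hδ, hT⟩ := hF.exists_taylor hc (isCompact_uIcc (a := s) (b := t)) hη0
  filter_upwards [Metric.ball_mem_nhds x (show 0 < δ / c by positivity)] with z hz
  rw [mem_ball, dist_eq_norm, lt_div_iff₀ hc0] at hz
  have hdist : ∀ τ ∈ uIcc s t, ‖X s z τ - X s x τ‖ ≤ ‖z - x‖ * c := fun τ hτ => by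
    have h1 := norm_sub_le_of_isIntegralCurve hL (hX.curve s z) (hX.curve s x) s τ
    rw [hX.init, hX.init] at h1
    refine h1.trans ?_
    have := abs_sub_left_of_mem_uIcc hτ
    gcongr
    exact Real.exp_le_exp.2 (by gcongr)
  have hlin : IsIntegralCurve (fun τ => R τ (z - x)) fun τ k => F' (τ, X s x τ) k := fun τ => by
    simpa using (hR τ).clm_apply (hasDerivAt_const τ (z - x))
  have hzd : ∀ τ, HasDerivAt (fun τ => X s z τ - X s x τ)
      (F τ (X s z τ) - F τ (X s x τ)) τ := fun τ => ((hX.curve s z) τ).sub ((hX.curve s x) τ)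
  -- the difference of two trajectories solves the linearised equation up to a small error
  have := norm_sub_le_of_approx (F := fun τ k => F' (τ, X s x τ) k) (K := K)
    (fun τ => (F' (τ, X s x τ)).lipschitzWith_of_opNorm_le (hF.bound _)) hlin hzd (s := s) (t := t)
    (ε := η * (‖z - x‖ * c)) (by positivity) (fun τ hτ => by
      have h2 := hdist τ hτ
      refine (hT τ hτ _ (h2.trans_lt hz)).trans ?_
      gcongr)
  simp only [hR0, ContinuousLinearMap.id_apply, hX.init, sub_self, norm_zero, zero_add] at this
  rw [← norm_neg]
  have e : -(X s z t - X s x t - (R t) (z - x)) = (R t) (z - x) - (X s z t - X s x t) := by abel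
  rw [e]
  refine this.trans ?_
  calc η * (‖z - x‖ * c) * |t - s| * c ≤ η * (‖z - x‖ * c) * (|t - s| + 1) * c := by
        gcongr; linarith
    _ = ε * ‖z - x‖ := by rw [hη]; field_simp

/-- The derivative of the flow in the initial state depends continuously on the initial datum. -/
theorem continuous_variation (hX : IsFlow F X) (hF : IsC1Bounded F F' K)
    {R : ℝ → E → ℝ → E →L[ℝ] E} (hR0 : ∀ s x, R s x s = ContinuousLinearMap.id ℝ E)
    (hR : ∀ s x, IsIntegralCurve (R s x) fun t A => (F' (t, X s x t)).comp A) (T : ℝ) :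
    Continuous fun p : ℝ × E => R p.1 p.2 T := by
  have hL := hF.lipschitzWith
  have hcX := hX.continuous hL
  have hcF := hF.continuous_deriv
  rw [continuous_iff_continuousAt]
  rintro ⟨s, x⟩
  have hcR := (hR s x).continuous
  have hXc := (hX.curve s x).continuous
  set S : Set ℝ := Icc (min s T - 1) (max s T + 1) with hS
  have hSc : IsCompact S := isCompact_Icc
  have hbound : ∀ ε > 0, ∀ᶠ p : ℝ × E in 𝓝 (s, x), ‖R p.1 p.2 T - R s x T‖ ≤
      (‖ContinuousLinearMap.id ℝ E - R s x p.1‖ + ε * |T - p.1|) * Real.exp (K * |T - p.1|) := by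
    intro ε hε
    have h1 : ∀ᶠ p : ℝ × E in 𝓝 (s, x), ∀ τ ∈ S,
        ‖F' (τ, X s x τ) - F' (τ, X p.1 p.2 τ)‖ * ‖R s x τ‖ < ε := by
      refine hSc.eventually_forall_of_forall_eventually fun τ _ => ?_
      have hc : Continuous fun z : (ℝ × E) × ℝ =>
          ‖F' (z.2, X s x z.2) - F' (z.2, X z.1.1 z.1.2 z.2)‖ * ‖R s x z.2‖ := by
        have h3 : Continuous fun z : (ℝ × E) × ℝ => F' (z.2, X z.1.1 z.1.2 z.2) :=
          hcF.comp (continuous_snd.prodMk hcX)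
        have h4 : Continuous fun z : (ℝ × E) × ℝ => F' (z.2, X s x z.2) := by fun_prop
        exact (h4.sub h3).norm.mul (hcR.comp continuous_snd).norm
      exact hc.continuousAt.eventually_lt continuousAt_const (by simpa using hε)
    have h2 : ∀ᶠ p : ℝ × E in 𝓝 (s, x), p.1 ∈ Icc (s - 1) (s + 1) :=
      (continuous_fst.tendsto (s, x)).eventually (Icc_mem_nhds (by simp) (by simp))
    filter_upwards [h1, h2] with p hp hps
    have hsub : uIcc p.1 T ⊆ S := by
      refine uIcc_subset_Icc ⟨?_, ?_⟩ ⟨?_, ?_⟩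
      · linarith [min_le_left s T, hps.1]
      · linarith [le_max_left s T, hps.2]
      · linarith [min_le_right s T]
      · linarith [le_max_right s T]
    have := norm_sub_le_of_approx (F := fun t A => (F' (t, X p.1 p.2 t)).comp A) (K := K)
      (fun t => LipschitzWith.of_dist_le_mul fun A B => by
        rw [dist_eq_norm, dist_eq_norm, ← ContinuousLinearMap.comp_sub]
        exact (ContinuousLinearMap.opNorm_comp_le _ _).trans (by gcongr; exact hF.bound _))
      (hR p.1 p.2) (hR s x) (s := p.1) (t := T) hε.le (fun τ hτ => by
        rw [← ContinuousLinearMap.sub_comp]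
        exact (ContinuousLinearMap.opNorm_comp_le _ _).trans (hp τ (hsub hτ)).le)
    rwa [hR0] at this
  rw [ContinuousAt, Metric.tendsto_nhds]
  intro ε hε
  set η : ℝ := ε / (2 * ((|T - s| + 1) * Real.exp (K * |T - s|))) with hη
  have hη0 : 0 < η := by positivity
  have hc : Continuous fun p : ℝ × E =>
      (‖ContinuousLinearMap.id ℝ E - R s x p.1‖ + η * |T - p.1|) * Real.exp (K * |T - p.1|) := by
    fun_prop
  have hlt : (‖ContinuousLinearMap.id ℝ E - R s x s‖ + η * |T - s|) * Real.exp (K * |T - s|)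
      < ε := by
    rw [hR0, sub_self, norm_zero, zero_add]
    calc η * |T - s| * Real.exp (K * |T - s|)
        ≤ η * (|T - s| + 1) * Real.exp (K * |T - s|) := by gcongr; linarith
      _ = ε / 2 := by rw [hη]; field_simp
      _ < ε := by linarith
  filter_upwards [hbound η hη0, hc.continuousAt.eventually_lt
    (continuousAt_const (y := ε) (x := ((s, x) : ℝ × E))) hlt] with p h1 h2
  rw [dist_eq_norm]
  exact h1.trans_lt h2

/-- A flow of class `C¹` in the state is of class `C¹` in the initial time and the initial state
together. The derivative in the initial time comes from the fact that the terminal value is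
constant along trajectories. -/
theorem exists_hasFDerivAt [CompleteSpace E] (hX : IsFlow F X) (hF : IsC1Bounded F F' K) (T : ℝ) :
    ∃ D : ℝ × E → ℝ × E →L[ℝ] E, Continuous D ∧
      ∀ p : ℝ × E, HasFDerivAt (fun q : ℝ × E => X q.1 q.2 T) (D p) p := by
  have hL := hF.lipschitzWith
  have hcX := hX.continuous hL
  have hcF := hF.continuous_deriv
  have hcF0 := hF.continuous
  have hex : ∀ s x, ∃ R : ℝ → E →L[ℝ] E, R s = ContinuousLinearMap.id ℝ E ∧
      IsIntegralCurve R fun t A => (F' (t, X s x t)).comp A := fun s x => by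
    have hXc := (hX.curve s x).continuous
    refine exists_isIntegralCurve (F := fun t A => (F' (t, X s x t)).comp A) (K := K)
      ?_ (fun t => LipschitzWith.of_dist_le_mul fun A B => ?_) s _
    · have : Continuous fun p : ℝ × (E →L[ℝ] E) => (F' (p.1, X s x p.1)).comp p.2 := by fun_prop
      exact this
    · rw [dist_eq_norm, dist_eq_norm, ← ContinuousLinearMap.comp_sub]
      exact (ContinuousLinearMap.opNorm_comp_le _ _).trans (by gcongr; exact hF.bound _)
  choose R hR0 hR using hex
  have hRc := hX.continuous_variation hF hR0 hR T
  refine ⟨fun p => (R p.1 p.2 T).comp (ContinuousLinearMap.snd ℝ ℝ E -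
    (ContinuousLinearMap.fst ℝ ℝ E).smulRight (F p.1 p.2)), ?_, ?_⟩
  · have : Continuous fun p : ℝ × E => F p.1 p.2 := hcF0
    have h2 : Continuous fun p : ℝ × E =>
        (ContinuousLinearMap.fst ℝ ℝ E).smulRight (F p.1 p.2) :=
      ((ContinuousLinearMap.smulRightL ℝ (ℝ × E) E)
        (ContinuousLinearMap.fst ℝ ℝ E)).continuous.comp this
    exact hRc.clm_comp (continuous_const.sub h2)
  rintro ⟨s, x⟩
  simp only
  set A := R s x T with hA
  set u : ℝ × E → E := fun q => q.2 - X s x q.1 with hu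
  have hu' : HasFDerivAt u (ContinuousLinearMap.snd ℝ ℝ E -
      (ContinuousLinearMap.fst ℝ ℝ E).smulRight (F s x)) (s, x) := by
    have h1 := (hX.curve s x) s
    rw [hX.init] at h1
    have h2 : HasFDerivAt (fun q : ℝ × E => X s x q.1)
        ((ContinuousLinearMap.fst ℝ ℝ E).smulRight (F s x)) (s, x) := by
      have := h1.hasFDerivAt.comp ((s, x) : ℝ × E) (hasFDerivAt_fst (𝕜 := ℝ) (p := (s, x)))
      refine this.congr_fderiv ?_
      ext <;> simp
    exact hasFDerivAt_snd.sub h2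
  have hu0 : u (s, x) = 0 := by simp [hu, hX.init]
  have hAu := A.hasFDerivAt.comp (s, x) hu'
  -- `X q.1 (X s x q.1) T = X s x T`, so the increment in `q` is an increment in the state alone
  have hlo : (fun q : ℝ × E => X q.1 q.2 T - A (u q) - X s x T) =o[𝓝 (s, x)] u := by
    refine Asymptotics.isLittleO_iff.2 fun ε hε => ?_
    have h1 : ∀ᶠ q : ℝ × E in 𝓝 (s, x), ‖R q.1 q.2 T - A‖ < ε := by
      have hc : Continuous fun q : ℝ × E => ‖R q.1 q.2 T - A‖ := by fun_prop
      exact hc.continuousAt.eventually_lt continuousAt_const (by simpa [hA] using hε)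
    obtain ⟨δ, hδ, hball⟩ := Metric.eventually_nhds_iff_ball.1 h1
    have hXc := (hX.curve s x).continuous
    have h2 : ∀ᶠ q : ℝ × E in 𝓝 (s, x), X s x q.1 ∈ ball x δ := by
      have hc : Continuous fun q : ℝ × E => X s x q.1 := by fun_prop
      exact hc.continuousAt.eventually (by
        simp only [hX.init]; exact ball_mem_nhds x hδ)
    filter_upwards [h2, ball_mem_nhds (s, x) hδ] with q hq hq2
    rw [← ball_prod_same] at hq2
    have := (convex_ball x δ).norm_image_sub_le_of_norm_hasFDerivWithin_le' (𝕜 := ℝ)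
      (f := fun z => X q.1 z T) (f' := fun z => R q.1 z T) (φ := A) (C := ε)
      (fun z _ => (hX.hasFDerivAt_state hF (hR0 q.1 z) (hR q.1 z) T).hasFDerivWithinAt)
      (fun z hz => (hball (q.1, z) (by rw [← ball_prod_same]; exact ⟨hq2.1, hz⟩)).le)
      hq hq2.2
    simp only [hX.restart hL] at this
    simp only [hu]
    convert this using 2
    abel
  have hO : u =O[𝓝 (s, x)] fun q => q - (s, x) := by
    simpa [hu0] using hu'.isBigO_sub
  have hlo2 := hlo.trans_isBigO hO
  have hfin : HasFDerivAt (fun q : ℝ × E => X q.1 q.2 T - A (u q)) (0 : ℝ × E →L[ℝ] E) (s, x) := by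
    refine HasFDerivAt.of_isLittleO (hlo2.congr_left fun q => ?_)
    simp [hu0]
  exact ((hfin.add hAu).congr_fderiv (zero_add _)).congr_of_eventuallyEq
    (.of_forall fun q => by simp)

end IsFlow

end Flow

/-! ### The cost as a function of the initial datum -/

section Value

variable {E : Type*} [NormedAddCommGroup E] [NormedSpace ℝ E]

/-- The cost `∫_s^T L(τ,y(τ)) dτ + g(y(T))` of the trajectory `y = X s x` that starts in `x` at
time `s`. -/
noncomputable def value (X : ℝ → E → ℝ → E) (L : ℝ → E → ℝ) (g : E → ℝ) (T : ℝ) (p : ℝ × E) : ℝ :=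
  (∫ τ in p.1..T, L τ (X p.1 p.2 τ)) + g (X p.1 p.2 T)

variable {F : ℝ → E → E} {X : ℝ → E → ℝ → E} {K K' : ℝ≥0}
  {F' : ℝ × E → E →L[ℝ] E} {L : ℝ → E → ℝ} {L' : ℝ × E → E →L[ℝ] ℝ} {g : E → ℝ}

theorem IsC1Bounded.augment (hF : IsC1Bounded F F' K) (hL : IsC1Bounded L L' K') :
    IsC1Bounded (fun t (q : E × ℝ) => (F t q.1, L t q.1))
      (fun p => ((F' (p.1, p.2.1)).comp (ContinuousLinearMap.fst ℝ E ℝ)).prod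
        ((L' (p.1, p.2.1)).comp (ContinuousLinearMap.fst ℝ E ℝ))) (max K K') where
  continuous := by
    have h1 : Continuous fun p : ℝ × (E × ℝ) => F p.1 p.2.1 :=
      hF.continuous.comp (continuous_fst.prodMk continuous_snd.fst)
    have h2 : Continuous fun p : ℝ × (E × ℝ) => L p.1 p.2.1 :=
      hL.continuous.comp (continuous_fst.prodMk continuous_snd.fst)
    exact h1.prodMk h2
  hasFDerivAt t q := by
    have h1 := (hF.hasFDerivAt t q.1).comp q (hasFDerivAt_fst (𝕜 := ℝ) (p := q))
    have h2 := (hL.hasFDerivAt t q.1).comp q (hasFDerivAt_fst (𝕜 := ℝ) (p := q))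
    exact h1.prodMk h2
  continuous_deriv := by
    have h1 : Continuous fun p : ℝ × (E × ℝ) => F' (p.1, p.2.1) :=
      hF.continuous_deriv.comp (continuous_fst.prodMk continuous_snd.fst)
    have h2 : Continuous fun p : ℝ × (E × ℝ) => L' (p.1, p.2.1) :=
      hL.continuous_deriv.comp (continuous_fst.prodMk continuous_snd.fst)
    exact (ContinuousLinearMap.prodₗᵢ ℝ (𝕜 := ℝ)).continuous.comp
      ((h1.clm_comp continuous_const).prodMk (h2.clm_comp continuous_const))
  bound p := by
    refine ContinuousLinearMap.opNorm_le_bound _ (by positivity) fun q => ?_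
    have hq := norm_fst_le q
    refine norm_prod_le_iff.2 ⟨?_, ?_⟩
    · refine ((F' (p.1, p.2.1)).le_of_opNorm_le (hF.bound _) q.1).trans ?_
      gcongr
      exact le_max_left _ _
    · refine ((L' (p.1, p.2.1)).le_of_opNorm_le (hL.bound _) q.1).trans ?_
      gcongr
      exact le_max_right _ _

/-- The cost is a function of class `C¹` of the initial datum: with the accumulated cost as an
additional state, it is a function of the terminal state of a `C¹` flow. -/
theorem contDiff_value [CompleteSpace E] (hX : IsFlow F X) (hF : IsC1Bounded F F' K)
    (hL : IsC1Bounded L L' K') (hg : ContDiff ℝ 1 g) (T : ℝ) : ContDiff ℝ 1 (value X L g T) := by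
  have hA := hF.augment hL
  obtain ⟨Y, hY⟩ := exists_isFlow hA.continuous hA.lipschitzWith
  obtain ⟨D, hD, hD'⟩ := hY.exists_hasFDerivAt hA T
  have h1 : ContDiff ℝ 1 fun q : ℝ × (E × ℝ) => Y q.1 q.2 T :=
    contDiff_one_iff_hasFDerivAt.2 ⟨D, hD, hD'⟩
  have h2 : ContDiff ℝ 1 fun p : ℝ × E => Y p.1 (p.2, 0) T :=
    h1.comp (contDiff_fst.prodMk (contDiff_snd.prodMk contDiff_const))
  have h3 : ∀ p : ℝ × E, Y p.1 (p.2, 0) T =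
      (X p.1 p.2 T, ∫ τ in p.1..T, L τ (X p.1 p.2 τ)) := fun p => by
    have hXc := (hX.curve p.1 p.2).continuous
    have hc : Continuous fun τ => L τ (X p.1 p.2 τ) :=
      hL.continuous.comp (continuous_id.prodMk hXc)
    have hcurve : IsIntegralCurve (fun t => (X p.1 p.2 t, ∫ τ in p.1..t, L τ (X p.1 p.2 τ)))
        (fun t (q : E × ℝ) => (F t q.1, L t q.1)) := fun t =>
      ((hX.curve p.1 p.2) t).prodMk (intervalIntegral.integral_hasDerivAt_right
        (hc.intervalIntegrable _ _) hc.aestronglyMeasurable.stronglyMeasurableAtFilter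
        hc.continuousAt)
    have := hY.eq_of_curve hA.lipschitzWith hcurve p.1
    simp only [hX.init, intervalIntegral.integral_same] at this
    rw [this]
  have h4 : value X L g T = fun p : ℝ × E => (Y p.1 (p.2, 0) T).2 + g (Y p.1 (p.2, 0) T).1 := by
    ext p
    rw [h3]
    rfl
  rw [h4]
  exact h2.snd.add (hg.comp h2.fst)

theorem value_terminal (hX : IsFlow F X) (T : ℝ) (x : E) : value X L g T (T, x) = g x := by
  simp [value, hX.init]

/-- The transport equation `∂ₛW + D_xW · F + L = 0` for the cost `W` along the flow of `F`. -/
theorem fderiv_value [CompleteSpace E] (hX : IsFlow F X) (hF : IsC1Bounded F F' K)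
    (hL : IsC1Bounded L L' K') (hg : ContDiff ℝ 1 g) (T s : ℝ) (x : E) :
    fderiv ℝ (value X L g T) (s, x) (1, F s x) = -L s x := by
  have hXc := (hX.curve s x).continuous
  have hc : Continuous fun τ => L τ (X s x τ) :=
    hL.continuous.comp (continuous_id.prodMk hXc)
  have hW := ((contDiff_value hX hF hL hg T).differentiable one_ne_zero (s, x)).hasFDerivAt
  have hcurve : HasDerivAt (fun t => (t, X s x t)) (1, F s x) s := by
    have := (hX.curve s x) s
    rw [hX.init] at this
    exact (hasDerivAt_id s).prodMk this
  have h1 : HasDerivAt (fun t => value X L g T (t, X s x t))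
      (fderiv ℝ (value X L g T) (s, x) (1, F s x)) s := by
    have h0 : (fun t => (t, X s x t)) s = (s, x) := by simp [hX.init]
    rw [← h0] at hW
    have := hW.comp_hasDerivAt s hcurve
    simpa only [hX.init] using! this
  have h2 : (fun t => value X L g T (t, X s x t)) =
      fun t => (∫ τ in t..T, L τ (X s x τ)) + g (X s x T) := by
    ext t
    simp [value, hX.restart hF.lipschitzWith]
  have h3 : HasDerivAt (fun t => (∫ τ in t..T, L τ (X s x τ)) + g (X s x T)) (-L s x) s := by
    have := (intervalIntegral.integral_hasDerivAt_left (hc.intervalIntegrable s T)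
      hc.aestronglyMeasurable.stronglyMeasurableAtFilter hc.continuousAt).add_const (g (X s x T))
    simpa only [hX.init] using! this
  rw [h2] at h1
  exact h1.unique h3

/-- The cost of an arbitrary curve, compared with the cost `W` of the flow: the two differ by the
integral of `D_xW · (y' - F)`. -/
theorem integral_add_eq_value_add [CompleteSpace E] (hX : IsFlow F X) (hF : IsC1Bounded F F' K)
    (hL : IsC1Bounded L L' K') (hg : ContDiff ℝ 1 g) {s T : ℝ} (hsT : s ≤ T) {y y' : ℝ → E}
    (hy : ContinuousOn y (Icc s T)) (hy' : ∀ t ∈ Ioo s T, HasDerivAt y (y' t) t)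
    (hyc : ContinuousOn y' (Icc s T)) :
    (∫ t in s..T, L t (y t)) + g (y T) = value X L g T (s, y s) +
      ∫ t in s..T, fderiv ℝ (value X L g T) (t, y t) (0, y' t - F t (y t)) := by
  have hWd := contDiff_value hX hF hL hg T
  have hty : ContinuousOn (fun t => (t, y t)) (Icc s T) := continuousOn_id.prodMk hy
  have hD : ContinuousOn (fun t => fderiv ℝ (value X L g T) (t, y t)) (Icc s T) :=
    (hWd.continuous_fderiv one_ne_zero).comp_continuousOn hty
  have hcF : ContinuousOn (fun t => F t (y t)) (Icc s T) := hF.continuous.comp_continuousOn hty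
  have hcL : ContinuousOn (fun t => L t (y t)) (Icc s T) := hL.continuous.comp_continuousOn hty
  have hc1 : ContinuousOn (fun t => fderiv ℝ (value X L g T) (t, y t) (1, y' t)) (Icc s T) :=
    hD.clm_apply (continuousOn_const.prodMk hyc)
  have hc2 : ContinuousOn (fun t => fderiv ℝ (value X L g T) (t, y t) (0, y' t - F t (y t)))
      (Icc s T) := hD.clm_apply (continuousOn_const.prodMk (hyc.sub hcF))
  have hftc := intervalIntegral.integral_eq_sub_of_hasDerivAt_of_le hsT
    (f := fun t => value X L g T (t, y t)) (hWd.continuous.comp_continuousOn hty)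
    (f' := fun t => fderiv ℝ (value X L g T) (t, y t) (1, y' t))
    (fun t ht => by
      have := ((hWd.differentiable one_ne_zero (t, y t)).hasFDerivAt).comp_hasDerivAt t
        ((hasDerivAt_id t).prodMk (hy' t ht))
      exact this)
    (hc1.intervalIntegrable_of_Icc hsT)
  have hsplit : (fun t => fderiv ℝ (value X L g T) (t, y t) (1, y' t)) = fun t =>
      fderiv ℝ (value X L g T) (t, y t) (0, y' t - F t (y t)) - L t (y t) := by
    ext t
    have h1 : ((1, y' t) : ℝ × E) = (0, y' t - F t (y t)) + (1, F t (y t)) := by simp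
    rw [h1, map_add, fderiv_value hX hF hL hg]
    ring
  rw [hsplit, intervalIntegral.integral_sub (hc2.intervalIntegrable_of_Icc hsT)
    (hcL.intervalIntegrable_of_Icc hsT), value_terminal hX] at hftc
  linarith

end Value

/-! ### Mollification in the space variable -/

section Mollify

variable {E : Type*} [NormedAddCommGroup E] [NormedSpace ℝ E]
  [MeasurableSpace E] [BorelSpace E] (μ : Measure E) [μ.IsAddHaarMeasure]
  {V : Type*} [NormedAddCommGroup V] [NormedSpace ℝ V]

theorem hasFDerivAt_integral_smul_comp_sub {a : E → ℝ} (ha : Continuous a)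
    (ha' : HasCompactSupport a) {κ : E → V} (hκ : ContDiff ℝ 1 κ) (hκ' : HasCompactSupport κ)
    (y : E) :
    HasFDerivAt (fun y => ∫ z, a z • κ (y - z) ∂μ) (∫ z, a z • fderiv ℝ κ (y - z) ∂μ) y := by
  have hd := hκ.continuous_fderiv one_ne_zero
  obtain ⟨C, hC⟩ := hd.bounded_above_of_compact_support (hκ'.fderiv ℝ)
  have hκc := hκ.continuous
  have hint : ∀ y, Integrable (fun z => a z • κ (y - z)) μ := fun y =>
    Continuous.integrable_of_hasCompactSupport (by fun_prop) ha'.smul_right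
  have hint' : Integrable (fun z => a z • fderiv ℝ κ (y - z)) μ :=
    Continuous.integrable_of_hasCompactSupport (by fun_prop) ha'.smul_right
  refine hasFDerivAt_integral_of_dominated_of_fderiv_le (s := univ)
    (F' := fun y z => a z • fderiv ℝ κ (y - z)) (bound := fun z => ‖a z‖ * C)
    univ_mem (.of_forall fun y => (hint y).aestronglyMeasurable) (hint y)
    hint'.aestronglyMeasurable ?_ ?_ ?_
  · refine .of_forall fun z y _ => ?_
    rw [norm_smul]
    exact mul_le_mul_of_nonneg_left (hC _) (norm_nonneg _)
  · exact Continuous.integrable_of_hasCompactSupport (by fun_prop) (ha'.norm.mul_right)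
  · refine .of_forall fun z y _ => ?_
    have h1 := ((hκ.differentiable one_ne_zero) (y - z)).hasFDerivAt
    have h2 : HasFDerivAt (fun y => κ (y - z)) (fderiv ℝ κ (y - z)) y := by
      simpa using! h1.comp y ((hasFDerivAt_id y).sub_const z)
    exact h2.const_smul (a z)

/-- Mollification in the space variable approximates a compactly supported function `ψ(t,y)` of
class `C¹` in `y` by functions in `C([0,T]; C²(S))`, uniformly in the spatial derivative. -/
theorem exists_memCk_two_approx [FiniteDimensional ℝ E] {ψ : ℝ × E → ℝ}
    {ψ' : ℝ × E → E →L[ℝ] ℝ} (hψ : Continuous ψ)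
    (hψd : ∀ t y, HasFDerivAt (fun z => ψ (t, z)) (ψ' (t, y)) y) (hψ' : Continuous ψ')
    {S : Set E} (hS : IsCompact S) (hψS : ∀ t, ∀ y ∉ S, ψ (t, y) = 0)
    {Q : Set E} (hQ : IsCompact Q) (hQu : UniqueDiffOn ℝ Q) (T : ℝ) {ε : ℝ} (hε : 0 < ε) :
    ∃ φ : ℝ → E → ℝ, MemCk T Q 2 φ ∧
      ∀ t ∈ Icc 0 T, ∀ y ∈ Q, ‖fderiv ℝ (φ t) y - ψ' (t, y)‖ ≤ ε := by
  -- the scale of the mollifier comes from the uniform continuity of `ψ'`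
  obtain ⟨δ, hδ, hclose⟩ : ∃ δ > 0, ∀ h : E, ‖h‖ < δ → ∀ p ∈ Icc 0 T ×ˢ Q,
      ‖ψ' (p.1, p.2 + h) - ψ' (p.1, p.2)‖ < ε := by
    have h1 : ∀ᶠ h : E in 𝓝 0, ∀ p ∈ Icc 0 T ×ˢ Q,
        ‖ψ' (p.1, p.2 + h) - ψ' (p.1, p.2)‖ < ε := by
      refine (isCompact_Icc.prod hQ).eventually_forall_of_forall_eventually fun p _ => ?_
      have hc : Continuous fun z : E × (ℝ × E) =>
          ‖ψ' (z.2.1, z.2.2 + z.1) - ψ' (z.2.1, z.2.2)‖ := by fun_prop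
      exact hc.continuousAt.eventually_lt continuousAt_const (by simpa using hε)
    obtain ⟨δ, hδ, hb⟩ := Metric.eventually_nhds_iff_ball.1 h1
    exact ⟨δ, hδ, fun h hh => hb h (by simpa using hh)⟩
  let μ : Measure E := Measure.addHaar
  let b : ContDiffBump (0 : E) := ⟨δ / 2, δ, by positivity, by linarith⟩
  set ρ : E → ℝ := b.normed μ with hρ
  have hρs : ContDiff ℝ ((⊤ : ℕ∞) : WithTop ℕ∞) ρ := b.contDiff_normed
  have hρc : HasCompactSupport ρ := b.hasCompactSupport_normed
  have hψt : ∀ t, Continuous fun z => ψ (t, z) := fun t => by fun_prop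
  have hψtc : ∀ t, HasCompactSupport fun z => ψ (t, z) := fun t =>
    HasCompactSupport.intro hS (hψS t)
  let p : ℝ → E → FormalMultilinearSeries ℝ E ℝ := fun t y j =>
    ∫ z, ψ (t, z) • iteratedFDeriv ℝ j ρ (y - z) ∂μ
  let φ : ℝ → E → ℝ := fun t y => ∫ z, ψ (t, z) • ρ (y - z) ∂μ
  have hic : ∀ j : ℕ, Continuous (iteratedFDeriv ℝ j ρ) := fun j =>
    hρs.continuous_iteratedFDeriv (by exact_mod_cast le_top)
  have hi1 : ∀ j : ℕ, ContDiff ℝ 1 (iteratedFDeriv ℝ j ρ) := fun j =>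
    hρs.iteratedFDeriv_right (by exact_mod_cast le_top)
  have hpc : ∀ j : ℕ, Continuous fun q : ℝ × E => p q.1 q.2 j := fun j => by
    have h1 : (fun q : ℝ × E => p q.1 q.2 j) =
        fun q => ∫ z in S, ψ (q.1, z) • iteratedFDeriv ℝ j ρ (q.2 - z) ∂μ := by
      ext1 q
      exact (setIntegral_eq_integral_of_forall_compl_eq_zero fun z hz => by
        rw [hψS _ z hz, zero_smul]).symm
    rw [h1]
    refine continuous_parametric_integral_of_continuous
      (f := fun (q : ℝ × E) z => ψ (q.1, z) • iteratedFDeriv ℝ j ρ (q.2 - z)) ?_ hS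
    have := hic j
    simp only [Function.uncurry_def]
    fun_prop
  have hp : ∀ t, HasFTaylorSeriesUpTo 2 (φ t) (p t) := fun t => by
    refine ⟨fun y => ?_, fun m _ y => ?_, fun m _ => (hpc m).comp (Continuous.prodMk_right t)⟩
    · have hint : Integrable (fun z => ψ (t, z) • iteratedFDeriv ℝ 0 ρ (y - z)) μ :=
        Continuous.integrable_of_hasCompactSupport (by have := hic 0; fun_prop)
          (hψtc t).smul_right
      have := (continuousMultilinearCurryFin0 ℝ E
        ℝ).toContinuousLinearEquiv.toContinuousLinearMap.integral_comp_comm hint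
      exact this.symm
    · have h1 := hasFDerivAt_integral_smul_comp_sub μ (hψt t) (hψtc t) (hi1 m)
        (hρc.iteratedFDeriv m) y
      have hint : Integrable (fun z => ψ (t, z) • iteratedFDeriv ℝ (m + 1) ρ (y - z)) μ :=
        Continuous.integrable_of_hasCompactSupport (by have := hic (m + 1); fun_prop)
          (hψtc t).smul_right
      let c : (E [×m + 1]→L[ℝ] ℝ) →L[ℝ] (E →L[ℝ] E [×m]→L[ℝ] ℝ) :=
        (continuousMultilinearCurryLeftEquiv ℝ (fun _ : Fin (m + 1) => E)
          ℝ).toContinuousLinearEquiv.toContinuousLinearMap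
      have := ContinuousLinearMap.integral_comp_comm (𝕜 := ℝ) (Fₗ := E →L[ℝ] E [×m]→L[ℝ] ℝ) c hint
      refine h1.congr_fderiv ?_
      refine Eq.trans ?_ this
      rfl
  refine ⟨φ, ⟨fun t _ => ?_, fun j hj => ?_⟩, fun t ht y hy => ?_⟩
  · exact ((hp t).contDiff).contDiffOn
  · refine (hpc j).continuousOn.congr fun q hq => ?_
    rw [iteratedFDerivWithin_eq_iteratedFDeriv hQu
      (((hp q.1).contDiff.of_le (by exact_mod_cast hj)).contDiffAt) hq.2]
    exact ((hp q.1).eq_iteratedFDeriv (by exact_mod_cast hj) q.2).symm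
  · have hψ1 : ContDiff ℝ 1 fun z => ψ (t, z) :=
      contDiff_one_iff_hasFDerivAt.2 ⟨fun y => ψ' (t, y), by fun_prop, hψd t⟩
    have h1 := hasFDerivAt_integral_smul_comp_sub μ hρs.continuous hρc hψ1 (hψtc t) y
    -- with the derivative on the factor `ψ`, that of `φ` is the mollification of `ψ'`
    have h2 : (fun y => ∫ z, ρ z • ψ (t, y - z) ∂μ) = φ t := by
      ext1 y
      rw [← integral_sub_left_eq_self _ μ y]
      simp [φ, mul_comm]
    have h3 : ∀ y, fderiv ℝ (fun z => ψ (t, z)) y = ψ' (t, y) := fun y => (hψd t y).fderiv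
    simp only [h3] at h1
    rw [h2] at h1
    rw [h1.fderiv, ← dist_eq_norm]
    refine b.dist_normed_convolution_le (μ := μ) (g := fun z => ψ' (t, z))
      (by exact (hψ'.comp (Continuous.prodMk_right t)).aestronglyMeasurable) fun z hz => ?_
    have := hclose (z - y) (by simpa [dist_eq_norm] using hz) (t, y) ⟨ht, hy⟩
    rw [dist_eq_norm]
    simpa using this.le

end Mollify

/-! ### Continuation of functions on `[0,T] × closure Ω` to the whole space -/

section Extension

variable {E V W : Type*} [NormedAddCommGroup E] [NormedSpace ℝ E]
  [NormedAddCommGroup V] [NormedSpace ℝ V] [NormedAddCommGroup W] [NormedSpace ℝ W]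

/-- `k` and its spatial derivative `k'` are jointly continuous up to the boundary of
`[0,T] × Ω`; differentiability is required in the interior only. -/
structure IsC1On (T : ℝ) (Ω : Set E) (k : ℝ → E → V) (k' : ℝ × E → E →L[ℝ] V) : Prop where
  continuousOn : ContinuousOn (fun p : ℝ × E => k p.1 p.2) (Icc 0 T ×ˢ closure Ω)
  continuousOn_deriv : ContinuousOn k' (Icc 0 T ×ˢ closure Ω)
  hasFDerivAt : ∀ t ∈ Icc 0 T, ∀ y ∈ Ω, HasFDerivAt (k t) (k' (t, y)) y

theorem MemCk.continuousOn {T : ℝ} {Q : Set E} {n : ℕ} {v : ℝ → E → V} (h : MemCk T Q n v) :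
    ContinuousOn (fun p : ℝ × E => v p.1 p.2) (Icc 0 T ×ˢ Q) := by
  have h0 := h.2 0 (Nat.zero_le _)
  have := (continuousMultilinearCurryFin0 ℝ E V).continuous.comp_continuousOn h0
  refine this.congr fun p _ => ?_
  simp [iteratedFDerivWithin_zero_eq_comp]

theorem MemCk.fderivWithin {T : ℝ} {Q : Set E} (hQ : UniqueDiffOn ℝ Q) {n : ℕ} {v : ℝ → E → V}
    (h : MemCk T Q (n + 1) v) : MemCk T Q n fun t y => fderivWithin ℝ (v t) Q y := by
  refine ⟨fun t ht => (h.1 t ht).fderivWithin hQ (by norm_cast), fun j hj => ?_⟩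
  have h1 := h.2 (j + 1) (by omega)
  have := (continuousMultilinearCurryRightEquiv' ℝ j E V).continuous.comp_continuousOn h1
  refine this.congr fun p hp => ?_
  simp only [Function.comp]
  rw [iteratedFDerivWithin_succ_eq_comp_right hQ hp.2]
  simp

theorem MemCk.isC1On {T : ℝ} {Ω : Set E} (hΩ : IsOpen Ω) (hu : UniqueDiffOn ℝ (closure Ω))
    {v : ℝ → E → V} (h : MemCk T (closure Ω) 1 v) :
    IsC1On T Ω v fun p => _root_.fderivWithin ℝ (v p.1) (closure Ω) p.2 where
  continuousOn := h.continuousOn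
  continuousOn_deriv := (MemCk.fderivWithin (n := 0) hu h).continuousOn
  hasFDerivAt t ht y hy := by
    have hn : closure Ω ∈ 𝓝 y := mem_of_superset (hΩ.mem_nhds hy) subset_closure
    exact (((h.1 t ht).differentiableOn (by simp)) y
      (subset_closure hy)).hasFDerivWithinAt.hasFDerivAt hn

theorem MemCk.add_smul {T : ℝ} {Q : Set E} (hQ : UniqueDiffOn ℝ Q) {n : ℕ} {v φ : ℝ → E → V}
    (hv : MemCk T Q n v) (hφ : MemCk T Q n φ) (s : ℝ) : MemCk T Q n (v + s • φ) := by
  have hs : ∀ t ∈ Icc 0 T, ContDiffOn ℝ n (s • φ t) Q := fun t ht => (hφ.1 t ht).const_smul s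
  refine ⟨fun t ht => (hv.1 t ht).add (hs t ht), fun j hj => ?_⟩
  refine ((hv.2 j hj).add ((hφ.2 j hj).const_smul s)).congr fun p hp => ?_
  have h1 := ((hv.1 p.1 hp.1).of_le (show (j : WithTop ℕ∞) ≤ n by exact_mod_cast hj)) p.2 hp.2
  have h2 := ((hφ.1 p.1 hp.1).of_le (show (j : WithTop ℕ∞) ≤ n by exact_mod_cast hj)) p.2 hp.2
  have h3 := ((hs p.1 hp.1).of_le (show (j : WithTop ℕ∞) ≤ n by exact_mod_cast hj)) p.2 hp.2
  have e1 := iteratedFDerivWithin_add_apply h1 h3 hQ hp.2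
  have e2 := iteratedFDerivWithin_const_smul_apply (a := s) h2 hQ hp.2
  simp only [Pi.add_apply, Pi.smul_apply]
  rw [e1, e2]

namespace IsC1On

variable {T : ℝ} {Ω : Set E} {k l : ℝ → E → V} {k' l' : ℝ × E → E →L[ℝ] V}

theorem add (hk : IsC1On T Ω k k') (hl : IsC1On T Ω l l') :
    IsC1On T Ω (fun t y => k t y + l t y) (fun p => k' p + l' p) where
  continuousOn := hk.continuousOn.add hl.continuousOn
  continuousOn_deriv := hk.continuousOn_deriv.add hl.continuousOn_deriv
  hasFDerivAt t ht y hy := (hk.hasFDerivAt t ht y hy).add (hl.hasFDerivAt t ht y hy)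

theorem clm_comp (hk : IsC1On T Ω k k') (A : V →L[ℝ] W) :
    IsC1On T Ω (fun t y => A (k t y)) (fun p => A.comp (k' p)) where
  continuousOn := A.continuous.comp_continuousOn hk.continuousOn
  continuousOn_deriv := continuousOn_const.clm_comp hk.continuousOn_deriv
  hasFDerivAt t ht y hy := A.hasFDerivAt.comp y (hk.hasFDerivAt t ht y hy)

theorem norm_sq {H : Type*} [NormedAddCommGroup H] [InnerProductSpace ℝ H] {k : ℝ → E → H}
    {k' : ℝ × E → E →L[ℝ] H} (hk : IsC1On T Ω k k') :
    IsC1On T Ω (fun t y => ‖k t y‖ ^ 2) (fun p => 2 • (innerSL ℝ (k p.1 p.2)).comp (k' p)) where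
  continuousOn := hk.continuousOn.norm.pow 2
  continuousOn_deriv := (((innerSL ℝ).continuous.comp_continuousOn hk.continuousOn).clm_comp
    hk.continuousOn_deriv).const_smul 2
  hasFDerivAt t ht y hy := (hk.hasFDerivAt t ht y hy).norm_sq

theorem exists_lipschitzOnWith (hk : IsC1On T Ω k k') (hΩ : Convex ℝ Ω)
    (hc : IsCompact (closure Ω)) :
    ∃ K : ℝ≥0, ∀ t ∈ Icc 0 T, LipschitzOnWith K (k t) (closure Ω) := by
  obtain ⟨C, hC⟩ := (isCompact_Icc.prod hc).exists_bound_of_continuousOn hk.continuousOn_deriv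
  refine ⟨C.toNNReal, fun t ht => ?_⟩
  have h1 : LipschitzOnWith C.toNNReal (k t) Ω :=
    hΩ.lipschitzOnWith_of_nnnorm_hasFDerivWithin_le (𝕜 := ℝ)
      (fun y hy => (hk.hasFDerivAt t ht y hy).hasFDerivWithinAt) fun y hy => by
        have := hC (t, y) ⟨ht, subset_closure hy⟩
        rw [← NNReal.coe_le_coe, coe_nnnorm]
        exact this.trans (Real.le_coe_toNNReal C)
  refine LipschitzOnWith.closure ?_ h1
  exact hk.continuousOn.comp (Continuous.prodMk_right t).continuousOn fun y hy => ⟨ht, hy⟩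

end IsC1On

/-- The projection of the real line onto `[0,T]`, for `T ≥ 0`. -/
noncomputable def clamp (T t : ℝ) : ℝ := max 0 (min t T)

theorem continuous_clamp (T : ℝ) : Continuous (clamp T) := by
  unfold clamp; fun_prop

theorem clamp_mem {T : ℝ} (hT : 0 ≤ T) (t : ℝ) : clamp T t ∈ Icc 0 T :=
  ⟨le_max_left _ _, max_le hT (min_le_right _ _)⟩

theorem clamp_of_mem {T t : ℝ} (ht : t ∈ Icc 0 T) : clamp T t = t := by
  rw [clamp, min_eq_left ht.2, max_eq_right ht.1]

/-- The function `k`, given on `[0,T] × Ω`, cut off by `χ` in space and continued by constants in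
time. -/
noncomputable def cutExt {E V : Type*} [AddCommGroup V] [Module ℝ V] (T : ℝ) (χ : E → ℝ)
    (k : ℝ → E → V) (t : ℝ) (y : E) : V :=
  χ y • k (clamp T t) y

theorem cutExt_of_eq_one {E V : Type*} [AddCommGroup V] [Module ℝ V] {T : ℝ} {χ : E → ℝ}
    (k : ℝ → E → V) {t : ℝ} (ht : t ∈ Icc 0 T)
    {y : E} (hy : χ y = 1) : cutExt T χ k t y = k t y := by
  rw [cutExt, hy, one_smul, clamp_of_mem ht]

theorem continuous_of_eq_zero_off {X E V : Type*} [TopologicalSpace X] [TopologicalSpace E]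
    [TopologicalSpace V] [Zero V] {h : X × E → V} {S Ω : Set E}
    (hS : IsClosed S) (hΩ : IsOpen Ω) (hSΩ : S ⊆ Ω) (hc : ContinuousOn h (univ ×ˢ Ω))
    (h0 : ∀ p : X × E, p.2 ∉ S → h p = 0) : Continuous h := by
  rw [continuous_iff_continuousAt]
  intro p
  by_cases hp : p.2 ∈ S
  · exact hc.continuousAt ((isOpen_univ.prod hΩ).mem_nhds ⟨trivial, hSΩ hp⟩)
  · have h1 : ∀ᶠ q : X × E in 𝓝 p, q.2 ∉ S :=
      continuous_snd.continuousAt.eventually (hS.isOpen_compl.mem_nhds hp)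
    refine (continuousAt_const (y := (0 : V))).congr ?_
    filter_upwards [h1] with q hq using (h0 q hq).symm

theorem exists_bound_cutExt {E : Type*} [TopologicalSpace E] {T : ℝ} (hT : 0 ≤ T) {χ : E → ℝ}
    (hχc : HasCompactSupport χ) {k : ℝ → E → V}
    (hc : Continuous (Function.uncurry (cutExt T χ k))) :
    ∃ C, ∀ t y, ‖cutExt T χ k t y‖ ≤ C := by
  obtain ⟨C, hC⟩ := ((isCompact_Icc (a := 0) (b := T)).prod hχc).exists_bound_of_continuousOn
    hc.continuousOn
  refine ⟨max C 0, fun t y => ?_⟩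
  by_cases hy : y ∈ tsupport χ
  · have := hC (clamp T t, y) ⟨clamp_mem hT _, hy⟩
    simp only [Function.uncurry_apply_pair, cutExt, clamp_of_mem (clamp_mem hT t)] at this
    exact this.trans (le_max_left _ _)
  · simp [cutExt, image_eq_zero_of_notMem_tsupport hy]

/-- The derivative of `cutExt T χ k`. -/
noncomputable def cutExtDeriv (T : ℝ) (χ : E → ℝ) (k : ℝ → E → V) (k' : ℝ × E → E →L[ℝ] V)
    (p : ℝ × E) : E →L[ℝ] V :=
  χ p.2 • k' (clamp T p.1, p.2) + (fderiv ℝ χ p.2).smulRight (k (clamp T p.1) p.2)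

theorem IsC1On.exists_isC1Bounded_cutExt {T : ℝ} (hT : 0 ≤ T) {Ω : Set E} (hΩ : IsOpen Ω)
    {χ : E → ℝ} (hχ : ContDiff ℝ 1 χ) (hχc : HasCompactSupport χ) (hχΩ : tsupport χ ⊆ Ω)
    {k : ℝ → E → V} {k' : ℝ × E → E →L[ℝ] V} (hk : IsC1On T Ω k k') :
    ∃ K, IsC1Bounded (cutExt T χ k) (cutExtDeriv T χ k k') K := by
  have hcl : ContinuousOn (fun p : ℝ × E => (clamp T p.1, p.2)) (univ ×ˢ Ω) :=
    (((continuous_clamp T).comp continuous_fst).prodMk continuous_snd).continuousOn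
  have hmaps : MapsTo (fun p : ℝ × E => (clamp T p.1, p.2)) (univ ×ˢ Ω) (Icc 0 T ×ˢ closure Ω) :=
    fun p hp => ⟨clamp_mem hT _, subset_closure hp.2⟩
  have hkc := hk.continuousOn.comp hcl hmaps
  have hkc' := hk.continuousOn_deriv.comp hcl hmaps
  have hχ1 := hχ.continuous
  have hχ2 := hχ.continuous_fderiv one_ne_zero
  have hχ0 : ∀ y ∉ tsupport χ, χ y = 0 := fun y hy => image_eq_zero_of_notMem_tsupport hy
  have hχ0' : ∀ y ∉ tsupport χ, fderiv ℝ χ y = 0 := fun y hy =>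
    image_eq_zero_of_notMem_tsupport fun h => hy (tsupport_fderiv_subset ℝ h)
  have hc : Continuous fun p : ℝ × E => cutExt T χ k p.1 p.2 := by
    refine continuous_of_eq_zero_off (isClosed_tsupport χ) hΩ hχΩ ?_ fun p hp => ?_
    · exact (hχ1.comp continuous_snd).continuousOn.smul hkc
    · rw [cutExt, hχ0 _ hp, zero_smul]
  have hz : ∀ p : ℝ × E, p.2 ∉ tsupport χ → cutExtDeriv T χ k k' p = 0 := fun p hp => by
    ext; simp [cutExtDeriv, hχ0 _ hp, hχ0' _ hp]
  have hc' : Continuous (cutExtDeriv T χ k k') := by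
    refine continuous_of_eq_zero_off (isClosed_tsupport χ) hΩ hχΩ ?_ hz
    refine ((hχ1.comp continuous_snd).continuousOn.smul hkc').add ?_
    have h1 : Continuous fun q : (E →L[ℝ] ℝ) × V => q.1.smulRight q.2 :=
      (ContinuousLinearMap.smulRightL ℝ E V).continuous₂
    exact h1.comp_continuousOn ((hχ2.comp continuous_snd).continuousOn.prodMk hkc)
  obtain ⟨C, hC⟩ := ((isCompact_Icc (a := 0) (b := T)).prod hχc).exists_bound_of_continuousOn
    hc'.continuousOn
  have hCb : ∀ p, ‖cutExtDeriv T χ k k' p‖ ≤ C.toNNReal := fun p => by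
    by_cases hp : p.2 ∈ tsupport χ
    · have := hC (clamp T p.1, p.2) ⟨clamp_mem hT _, hp⟩
      have h2 : cutExtDeriv T χ k k' (clamp T p.1, p.2) = cutExtDeriv T χ k k' p := by
        simp only [cutExtDeriv, clamp_of_mem (clamp_mem hT p.1)]
      rw [h2] at this
      exact this.trans (Real.le_coe_toNNReal C)
    · rw [hz p hp, norm_zero]; exact NNReal.coe_nonneg _
  refine ⟨C.toNNReal, hc, fun t y => ?_, hc', hCb⟩
  by_cases hy : y ∈ tsupport χ
  · exact ((hχ.differentiable one_ne_zero) y).hasFDerivAt.smul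
      (hk.hasFDerivAt _ (clamp_mem hT t) y (hχΩ hy))
  · rw [hz (t, y) hy]
    refine (hasFDerivAt_const (0 : V) y).congr_of_eventuallyEq ?_
    filter_upwards [(isClosed_tsupport χ).isOpen_compl.mem_nhds hy] with z hz'
    rw [cutExt, hχ0 z hz', zero_smul]

/-- A smooth cutoff function that equals `1` within a positive distance of the compact set `S` and
has its support in the open set `Ω`. -/
theorem exists_cutoff [FiniteDimensional ℝ E] {S Ω : Set E} (hS : IsCompact S) (hΩ : IsOpen Ω)
    (hSΩ : S ⊆ Ω) :
    ∃ χ : E → ℝ, ContDiff ℝ 1 χ ∧ HasCompactSupport χ ∧ tsupport χ ⊆ Ω ∧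
      ∃ δ > 0, ∀ x ∈ S, ∀ y, ‖y - x‖ < δ → χ y = 1 := by
  obtain ⟨Q, hQ, hSQ, hQΩ⟩ := exists_compact_between hS hΩ hSΩ
  obtain ⟨χ, h1, h0, -⟩ := exists_contMDiffMap_one_nhds_of_subset_interior (n := 1)
    (modelWithCornersSelf ℝ E) hS.isClosed hSQ
  have hsub : tsupport χ ⊆ Q := closure_minimal (fun x hx => by
    by_contra h; exact hx (h0 x h)) hQ.isClosed
  refine ⟨χ, χ.contMDiff.contDiff, HasCompactSupport.of_support_subset_isCompact hQ
    (subset_closure.trans hsub), hsub.trans hQΩ, ?_⟩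
  obtain ⟨u, hu, hSu, huχ⟩ := mem_nhdsSet_iff_exists.1 h1
  obtain ⟨δ, hδ, hδu⟩ := hS.exists_thickening_subset_open hu hSu
  refine ⟨δ, hδ, fun x hx y hy => huχ (hδu ?_)⟩
  exact mem_thickening_iff.2 ⟨x, hx, by rwa [dist_eq_norm]⟩

end Extension

/-! ### The cut-off closed-loop flow -/

section Gradient

variable {E : Type*} [NormedAddCommGroup E] [InnerProductSpace ℝ E] [FiniteDimensional ℝ E]

/-- The Riesz isomorphism `E* → E`, as a real-linear map: it sends a derivative to a gradient. -/
noncomputable def riesz (E : Type*) [NormedAddCommGroup E] [InnerProductSpace ℝ E]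
    [FiniteDimensional ℝ E] : (E →L[ℝ] ℝ) →L[ℝ] E :=
  LinearMap.toContinuousLinearMap
    { toFun := fun a => (InnerProductSpace.toDual ℝ E).symm a
      map_add' := fun a b => map_add _ a b
      map_smul' := fun c a => by simp }

theorem inner_riesz (a : E →L[ℝ] ℝ) (x : E) : inner ℝ (riesz E a) x = a x :=
  InnerProductSpace.toDual_symm_apply

theorem gradientWithin_eq_riesz (f : E → ℝ) (s : Set E) (x : E) :
    gradientWithin f s x = riesz E (fderivWithin ℝ f s x) := rfl

theorem gradient_eq_riesz (f : E → ℝ) (x : E) : gradient f x = riesz E (fderiv ℝ f x) := rfl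

end Gradient

namespace Problem

variable {d M : ℕ} (P : Problem d M) {v φ : ℝ → State d → ℝ}

/-- The right-hand side `f + B U_v` of the closed-loop problem. -/
noncomputable def field (v : ℝ → State d → ℝ) (t : ℝ) (y : State d) : State d :=
  P.f t y + P.B (P.U v t y)

/-- The running cost `ℓ + β/2 |U_v|²` of the feedback `U_v`. -/
noncomputable def running (v : ℝ → State d → ℝ) (t : ℝ) (y : State d) : ℝ :=
  P.ℓ t y + P.β / 2 * ‖P.U v t y‖ ^ 2

theorem isCompact_closure_Ω : IsCompact (closure P.Ω) := P.bounded_Ω.isCompact_closure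

theorem uniqueDiffOn_closure_Ω : UniqueDiffOn ℝ (closure P.Ω) := by
  rcases P.Ω.eq_empty_or_nonempty with h | h
  · simpa [h] using uniqueDiffOn_empty
  · refine uniqueDiffOn_convex P.convex_Ω.closure ?_
    exact (h.mono P.isOpen_Ω.subset_interior_closure)

theorem U_eq (v : ℝ → State d → ℝ) (t : ℝ) (y : State d) : P.U v t y =
    (-(1 / P.β) • (ContinuousLinearMap.adjoint P.B).comp (riesz (State d)))
      (fderivWithin ℝ (v t) (closure P.Ω) y) := by
  rw [U, gradientWithin_eq_riesz]
  simp

theorem exists_isC1On_U (hv : MemCk P.T (closure P.Ω) 2 v) : ∃ k', IsC1On P.T P.Ω (P.U v) k' := by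
  have h1 := MemCk.isC1On P.isOpen_Ω P.uniqueDiffOn_closure_Ω
    (MemCk.fderivWithin (n := 1) P.uniqueDiffOn_closure_Ω hv)
  have h2 := h1.clm_comp (-(1 / P.β) • (ContinuousLinearMap.adjoint P.B).comp (riesz (State d)))
  have h3 : P.U v = fun t y =>
      (-(1 / P.β) • (ContinuousLinearMap.adjoint P.B).comp (riesz (State d)))
        (fderivWithin ℝ (v t) (closure P.Ω) y) := by
    ext1 t; ext1 y; exact P.U_eq v t y
  rw [h3]
  exact ⟨_, h2⟩

theorem exists_isC1On_field (hv : MemCk P.T (closure P.Ω) 2 v) :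
    ∃ k', IsC1On P.T P.Ω (P.field v) k' := by
  obtain ⟨k', hk⟩ := P.exists_isC1On_U hv
  exact ⟨_, (P.f_mem.isC1On P.isOpen_Ω P.uniqueDiffOn_closure_Ω).add (hk.clm_comp P.B)⟩

theorem exists_isC1On_running (hv : MemCk P.T (closure P.Ω) 2 v) :
    ∃ k', IsC1On P.T P.Ω (P.running v) k' := by
  obtain ⟨k', hk⟩ := P.exists_isC1On_U hv
  exact ⟨_, (P.ℓ_mem.isC1On P.isOpen_Ω P.uniqueDiffOn_closure_Ω).add
    (hk.norm_sq.clm_comp (ContinuousLinearMap.mul ℝ ℝ (P.β / 2)))⟩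

theorem exists_isC1On_terminal : ∃ k', IsC1On P.T P.Ω (fun _ => P.g) k' := by
  have h : MemCk P.T (closure P.Ω) 1 (fun _ : ℝ => P.g) := by
    refine ⟨fun _ _ => P.g_contDiffOn, fun j hj => ?_⟩
    exact (P.g_contDiffOn.continuousOn_iteratedFDerivWithin (by exact_mod_cast hj)
      P.uniqueDiffOn_closure_Ω).comp continuousOn_snd fun p hp => hp.2
  exact ⟨_, h.isC1On P.isOpen_Ω P.uniqueDiffOn_closure_Ω⟩

theorem U_add_smul (hv : MemCk P.T (closure P.Ω) 2 v) (hφ : MemCk P.T (closure P.Ω) 2 φ) (s : ℝ)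
    {t : ℝ} (ht : t ∈ Icc 0 P.T) {y : State d} (hy : y ∈ closure P.Ω) :
    P.U (v + s • φ) t y = P.U v t y + s • P.U φ t y := by
  have h1 := ((hv.1 t ht).differentiableOn (by simp)) y hy
  have h2 := ((hφ.1 t ht).differentiableOn (by simp)) y hy
  have hu := P.uniqueDiffOn_closure_Ω y hy
  simp only [U_eq, Pi.add_apply, Pi.smul_apply]
  rw [fderivWithin_add hu h1 (h2.const_smul s), fderivWithin_const_smul hu h2]
  simp only [map_add, map_smul]

variable {P} in
theorem IsClosedLoop.continuousOn {K : ℝ → State d → Ctrl M} {t₀ : ℝ} {y₀ : State d}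
    {y : ℝ → State d} (h : P.IsClosedLoop K t₀ y₀ y) : ContinuousOn y (Icc t₀ P.T) :=
  fun t ht => (h.2 t ht).2.continuousWithinAt

theorem closedLoop_unique (hv : MemCk P.T (closure P.Ω) 2 v) {t₀ : ℝ} (ht₀ : 0 ≤ t₀)
    {y₀ : State d} {y z : ℝ → State d} (hy : P.IsClosedLoop (P.U v) t₀ y₀ y)
    (hz : P.IsClosedLoop (P.U v) t₀ y₀ z) : EqOn y z (Icc t₀ P.T) := by
  obtain ⟨k', hk⟩ := P.exists_isC1On_field hv
  obtain ⟨K, hK⟩ := hk.exists_lipschitzOnWith P.convex_Ω P.isCompact_closure_Ω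
  have hd : ∀ {w : ℝ → State d}, P.IsClosedLoop (P.U v) t₀ y₀ w → ∀ t ∈ Ico t₀ P.T,
      HasDerivWithinAt w (P.field v t (w t)) (Ici t) t := fun hw t ht =>
    ((hw.2 t (Ico_subset_Icc_self ht)).2).mono_of_mem_nhdsWithin (by
      have : Icc t P.T ⊆ Icc t₀ P.T := Icc_subset_Icc_left ht.1
      exact mem_of_superset (Icc_mem_nhdsGE ht.2) this)
  exact ODE_solution_unique_of_mem_Icc_right (v := P.field v) (s := fun _ => closure P.Ω) (K := K)
    (fun t ht => hK t ⟨ht₀.trans ht.1, ht.2.le⟩) hy.continuousOn (hd hy)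
    (fun t ht => (hy.2 t (Ico_subset_Icc_self ht)).1) hz.continuousOn (hd hz)
    (fun t ht => (hz.2 t (Ico_subset_Icc_self ht)).1) (hy.1.trans hz.1.symm)

theorem Φ_isClosedLoop {t₀ : ℝ} {y₀ : State d} (h : ∃ y, P.IsClosedLoop (P.U v) t₀ y₀ y) :
    P.IsClosedLoop (P.U v) t₀ y₀ (P.Φ v t₀ y₀) := by
  rw [Φ, dif_pos h]
  exact h.choose_spec

/-- `X` is the flow of the closed-loop vector field of `v`, cut off in space by `χ`. Contrary to
the closed-loop problem, it is defined for all times and initial data. -/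
structure IsCutFlow (χ : State d → ℝ) (v : ℝ → State d → ℝ) (X : ℝ → State d → ℝ → State d) :
    Prop where
  memCk : MemCk P.T (closure P.Ω) 2 v
  contDiff : ContDiff ℝ 1 χ
  hasCompactSupport : HasCompactSupport χ
  tsupport_subset : tsupport χ ⊆ P.Ω
  isFlow : IsFlow (cutExt P.T χ (P.field v)) X

/-- The cost of the trajectories of the cut-off flow, with the cut-off cost functions. It is a
function of class `C¹` on the whole space, equal to `𝒱 v` at the initial data from which the
trajectory stays where `χ = 1`. -/
noncomputable def cutValue (χ : State d → ℝ) (v : ℝ → State d → ℝ)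
    (X : ℝ → State d → ℝ → State d) : ℝ × State d → ℝ :=
  value X (cutExt P.T χ (P.running v)) (cutExt P.T χ (fun _ => P.g) 0) P.T

theorem exists_isCutFlow {χ : State d → ℝ} (hv : MemCk P.T (closure P.Ω) 2 v)
    (h1 : ContDiff ℝ 1 χ) (h2 : HasCompactSupport χ) (h3 : tsupport χ ⊆ P.Ω) :
    ∃ X, P.IsCutFlow χ v X := by
  obtain ⟨k', hk⟩ := P.exists_isC1On_field hv
  obtain ⟨K, hK⟩ := hk.exists_isC1Bounded_cutExt P.T_pos.le P.isOpen_Ω h1 h2 h3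
  obtain ⟨X, hX⟩ := exists_isFlow hK.continuous hK.lipschitzWith
  exact ⟨X, hv, h1, h2, h3, hX⟩

/-- The cost of a closed-loop trajectory along which the cutoff is not active. -/
theorem cost_eq_cutValue {χ : State d → ℝ} {X : ℝ → State d → ℝ → State d} {t₀ : ℝ}
    (ht₀ : t₀ ∈ Icc 0 P.T) {y₀ : State d}
    (hχ : ∀ t ∈ Icc t₀ P.T, χ (X t₀ y₀ t) = 1) {y : ℝ → State d}
    (hy : EqOn y (X t₀ y₀) (Icc t₀ P.T)) :
    (∫ t in t₀..P.T, P.running v t (y t)) + P.g (y P.T) = P.cutValue χ v X (t₀, y₀) := by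
  have hT : P.T ∈ Icc t₀ P.T := ⟨ht₀.2, le_rfl⟩
  rw [cutValue, value]
  congr 1
  · refine intervalIntegral.integral_congr fun t ht => ?_
    rw [uIcc_of_le ht₀.2] at ht
    simp only
    rw [cutExt_of_eq_one _ ⟨ht₀.1.trans ht.1, ht.2⟩ (hχ t ht), hy ht]
  · rw [cutExt_of_eq_one _ ⟨le_rfl, P.T_pos.le⟩ (hχ _ hT), hy hT]

namespace IsCutFlow

variable {P} {χ : State d → ℝ} {X : ℝ → State d → ℝ → State d}

theorem exists_isC1Bounded_field (h : P.IsCutFlow χ v X) :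
    ∃ F' K, IsC1Bounded (cutExt P.T χ (P.field v)) F' K := by
  obtain ⟨k', hk⟩ := P.exists_isC1On_field h.memCk
  exact ⟨_, hk.exists_isC1Bounded_cutExt P.T_pos.le P.isOpen_Ω h.contDiff h.hasCompactSupport
    h.tsupport_subset⟩

theorem exists_isC1Bounded_running (h : P.IsCutFlow χ v X) :
    ∃ L' K, IsC1Bounded (cutExt P.T χ (P.running v)) L' K := by
  obtain ⟨k', hk⟩ := P.exists_isC1On_running h.memCk
  exact ⟨_, hk.exists_isC1Bounded_cutExt P.T_pos.le P.isOpen_Ω h.contDiff h.hasCompactSupport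
    h.tsupport_subset⟩

theorem continuous_cutExt_U (h : P.IsCutFlow χ v X) (hφ : MemCk P.T (closure P.Ω) 2 φ) :
    Continuous fun p : ℝ × State d => cutExt P.T χ (P.U φ) p.1 p.2 := by
  obtain ⟨k', hk⟩ := P.exists_isC1On_U hφ
  obtain ⟨K, hK⟩ := hk.exists_isC1Bounded_cutExt P.T_pos.le P.isOpen_Ω h.contDiff
    h.hasCompactSupport h.tsupport_subset
  exact hK.continuous

theorem contDiff_terminal (h : P.IsCutFlow χ v X) :
    ContDiff ℝ 1 (cutExt P.T χ (fun _ => P.g) 0) := by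
  obtain ⟨k', hk⟩ := P.exists_isC1On_terminal
  obtain ⟨K, hK⟩ := hk.exists_isC1Bounded_cutExt P.T_pos.le P.isOpen_Ω h.contDiff
    h.hasCompactSupport h.tsupport_subset
  exact contDiff_one_iff_hasFDerivAt.2 ⟨_, hK.continuous_deriv.comp (Continuous.prodMk_right 0),
    hK.hasFDerivAt 0⟩

theorem contDiff_cutValue (h : P.IsCutFlow χ v X) : ContDiff ℝ 1 (P.cutValue χ v X) := by
  obtain ⟨F', K, hF⟩ := h.exists_isC1Bounded_field
  obtain ⟨L', K', hL⟩ := h.exists_isC1Bounded_running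
  exact contDiff_value h.isFlow hF hL h.contDiff_terminal P.T

theorem continuous_flow (h : P.IsCutFlow χ v X) :
    Continuous fun p : (ℝ × State d) × ℝ => X p.1.1 p.1.2 p.2 := by
  obtain ⟨F', K, hF⟩ := h.exists_isC1Bounded_field
  exact h.isFlow.continuous hF.lipschitzWith

theorem restart (h : P.IsCutFlow χ v X) (s t : ℝ) (x : State d) : X t (X s x t) = X s x := by
  obtain ⟨F', K, hF⟩ := h.exists_isC1Bounded_field
  exact h.isFlow.restart hF.lipschitzWith s t x

theorem mem_Ω_of_eq_one (h : P.IsCutFlow χ v X) {y : State d} (hy : χ y = 1) : y ∈ P.Ω :=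
  h.tsupport_subset (subset_closure (by simp [hy]))

/-- Where the cutoff is not active, trajectories of the cut-off flow solve the closed-loop
problem. -/
theorem isClosedLoop (h : P.IsCutFlow χ v X) {t₀ : ℝ} (ht₀ : 0 ≤ t₀) {y₀ : State d}
    (hχ : ∀ t ∈ Icc t₀ P.T, χ (X t₀ y₀ t) = 1) : P.IsClosedLoop (P.U v) t₀ y₀ (X t₀ y₀) := by
  refine ⟨h.isFlow.init _ _, fun t ht => ⟨subset_closure (h.mem_Ω_of_eq_one (hχ t ht)), ?_⟩⟩
  have := (h.isFlow.curve t₀ y₀ t).hasDerivWithinAt (s := Icc t₀ P.T)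
  rwa [cutExt_of_eq_one _ ⟨ht₀.trans ht.1, ht.2⟩ (hχ t ht)] at this

/-- Solutions of the closed-loop problem are trajectories of the cut-off flow, where the cutoff is
not active. -/
theorem eqOn_of_isClosedLoop (h : P.IsCutFlow χ v X) {t₀ : ℝ} (ht₀ : 0 ≤ t₀) {y₀ : State d}
    {y : ℝ → State d} (hy : P.IsClosedLoop (P.U v) t₀ y₀ y)
    (hχ : ∀ t ∈ Icc t₀ P.T, χ (y t) = 1) : EqOn y (X t₀ y₀) (Icc t₀ P.T) := by
  obtain ⟨F', K, hF⟩ := h.exists_isC1Bounded_field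
  refine ODE_solution_unique hF.lipschitzWith hy.continuousOn (fun t ht => ?_)
    (h.isFlow.curve t₀ y₀).continuous.continuousOn
    (fun t _ => (h.isFlow.curve t₀ y₀ t).hasDerivWithinAt) (hy.1.trans (h.isFlow.init _ _).symm)
  have ht' := Ico_subset_Icc_self ht
  rw [cutExt_of_eq_one _ ⟨ht₀.trans ht.1, ht.2.le⟩ (hχ t ht')]
  exact ((hy.2 t ht').2).mono_of_mem_nhdsWithin
    (mem_of_superset (Icc_mem_nhdsGE ht.2) (Icc_subset_Icc_left ht.1))

theorem Φ_eqOn (h : P.IsCutFlow χ v X) {t₀ : ℝ} (ht₀ : 0 ≤ t₀) {y₀ : State d}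
    (hχ : ∀ t ∈ Icc t₀ P.T, χ (X t₀ y₀ t) = 1) :
    EqOn (P.Φ v t₀ y₀) (X t₀ y₀) (Icc t₀ P.T) :=
  P.closedLoop_unique h.memCk ht₀ (P.Φ_isClosedLoop ⟨_, h.isClosedLoop ht₀ hχ⟩)
    (h.isClosedLoop ht₀ hχ)

theorem 𝒱_eq_cutValue (h : P.IsCutFlow χ v X) {t₀ : ℝ} (ht₀ : t₀ ∈ Icc 0 P.T) {y₀ : State d}
    (hχ : ∀ t ∈ Icc t₀ P.T, χ (X t₀ y₀ t) = 1) : P.𝒱 v t₀ y₀ = P.cutValue χ v X (t₀, y₀) :=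
  P.cost_eq_cutValue ht₀ hχ (h.Φ_eqOn ht₀.1 hχ)

end IsCutFlow

end Problem

/-! ### The reached set -/

namespace Problem

variable {d M : ℕ} (P : Problem d M) {v φ : ℝ → State d → ℝ}

/-- The initial data from which the trajectories of `X` stay in `S` up to the final time. -/
def Stays (X : ℝ → State d → ℝ → State d) (S : Set (State d)) : Set (ℝ × State d) :=
  {p | p.1 ∈ Icc 0 P.T ∧ ∀ t ∈ Icc p.1 P.T, X p.1 p.2 t ∈ S}

namespace IsCutFlow

variable {P} {χ : State d → ℝ} {X : ℝ → State d → ℝ → State d}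

theorem isClosed_stays (h : P.IsCutFlow χ v X) {S : Set (State d)} (hS : IsClosed S) :
    IsClosed (P.Stays X S) := by
  have h1 : P.Stays X S = {p | p.1 ∈ Icc 0 P.T} ∩
      ⋂ t ∈ Icc 0 P.T, {p | X p.1 p.2 (max p.1 t) ∈ S} := by
    ext p
    simp only [Stays, mem_ofPred_eq, mem_inter_iff, mem_iInter]
    refine and_congr_right fun hp => ⟨fun H t ht => H _ ⟨le_max_left _ _, max_le hp.2 ht.2⟩,
      fun H t ht => ?_⟩
    have := H t ⟨hp.1.trans ht.1, ht.2⟩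
    rwa [max_eq_right ht.1] at this
  rw [h1]
  refine (isClosed_Icc.preimage continuous_fst).inter (isClosed_biInter fun t _ => ?_)
  have hc : Continuous fun p : ℝ × State d => X p.1 p.2 (max p.1 t) :=
    h.continuous_flow.comp (continuous_id.prodMk (by fun_prop))
  exact hS.preimage hc

theorem stays_of_mem_ω (h : P.IsCutFlow χ v X) (hv : v ∈ P.D)
    (hχ : ∀ x ∈ closure (P.R v), χ x = 1) {t₀ : ℝ} (ht₀ : t₀ ∈ Ioo 0 P.T) {y₀ : State d}
    (hy₀ : y₀ ∈ P.ω) : EqOn (P.Φ v t₀ y₀) (X t₀ y₀) (Icc t₀ P.T) ∧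
      ∀ t ∈ Icc t₀ P.T, X t₀ y₀ t ∈ closure (P.R v) := by
  have hΦ := P.Φ_isClosedLoop (hv.2.1 t₀ (Ioo_subset_Icc_self ht₀) y₀ hy₀)
  have hR : MapsTo (P.Φ v t₀ y₀) (Ico t₀ P.T) (P.R v) := fun t ht =>
    ⟨t, ⟨ht₀.1.trans_le ht.1, ht.2⟩, t₀, ht₀, y₀, hy₀, t, ht, rfl⟩
  have hR' : MapsTo (P.Φ v t₀ y₀) (Icc t₀ P.T) (closure (P.R v)) := by
    rw [← closure_Ico ht₀.2.ne]
    refine hR.closure_of_continuousOn ?_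
    rw [closure_Ico ht₀.2.ne]
    exact hΦ.continuousOn
  have heq := h.eqOn_of_isClosedLoop ht₀.1.le hΦ fun t ht => hχ _ (hR' ht)
  exact ⟨heq, fun t ht => heq ht ▸ hR' ht⟩

theorem mem_G_iff (h : P.IsCutFlow χ v X) (hv : v ∈ P.D)
    (hχ : ∀ x ∈ closure (P.R v), χ x = 1) {p : ℝ × State d} :
    p ∈ P.G v ↔ ∃ t₀ ∈ Ioo 0 P.T, ∃ y₀ ∈ P.ω, p.1 ∈ Ico t₀ P.T ∧ p.2 = X t₀ y₀ p.1 := by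
  constructor
  · rintro ⟨t₀, ht₀, y₀, hy₀, t, ht, rfl⟩
    exact ⟨t₀, ht₀, y₀, hy₀, ht,
      (h.stays_of_mem_ω hv hχ ht₀ hy₀).1 (Ico_subset_Icc_self ht)⟩
  · rintro ⟨t₀, ht₀, y₀, hy₀, ht, hp⟩
    refine ⟨t₀, ht₀, y₀, hy₀, p.1, ht, Prod.ext rfl ?_⟩
    rw [hp]
    exact ((h.stays_of_mem_ω hv hχ ht₀ hy₀).1 (Ico_subset_Icc_self ht)).symm

theorem G_subset_stays (h : P.IsCutFlow χ v X) (hv : v ∈ P.D)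
    (hχ : ∀ x ∈ closure (P.R v), χ x = 1) : P.G v ⊆ P.Stays X (closure (P.R v)) := by
  intro p hp
  obtain ⟨t₀, ht₀, y₀, hy₀, ht, hp2⟩ := (h.mem_G_iff hv hχ).1 hp
  refine ⟨⟨ht₀.1.le.trans ht.1, ht.2.le⟩, fun t htt => ?_⟩
  rw [hp2, h.restart]
  exact (h.stays_of_mem_ω hv hχ ht₀ hy₀).2 t ⟨ht.1.trans htt.1, htt.2⟩

theorem closure_G_subset_stays (h : P.IsCutFlow χ v X) (hv : v ∈ P.D)
    (hχ : ∀ x ∈ closure (P.R v), χ x = 1) : closure (P.G v) ⊆ P.Stays X (closure (P.R v)) :=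
  closure_minimal (h.G_subset_stays hv hχ) (h.isClosed_stays isClosed_closure)

/-- The reached set is open: the cut-off flow, run backwards in time, is continuous and takes a
point of `𝒢(v)` to a slightly earlier starting time and a state in the open set `ω`. -/
theorem isOpen_G (h : P.IsCutFlow χ v X) (hv : v ∈ P.D)
    (hχ : ∀ x ∈ closure (P.R v), χ x = 1) : IsOpen (P.G v) := by
  rw [isOpen_iff_mem_nhds]
  intro p hp
  obtain ⟨t₁, ht₁, y₁, hy₁, htp, hp2⟩ := (h.mem_G_iff hv hχ).1 hp
  -- a starting time strictly before `p.1`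
  have hback : ∀ᶠ s in 𝓝[<] t₁, X t₁ y₁ s ∈ P.ω ∧ s ∈ Ioo 0 P.T := by
    refine (Filter.Eventually.and ?_ (Ioo_mem_nhds ht₁.1 ht₁.2)).filter_mono nhdsWithin_le_nhds
    refine (h.isFlow.curve t₁ y₁).continuous.continuousAt.eventually (P.isOpen_ω.mem_nhds ?_)
    rwa [h.isFlow.init]
  obtain ⟨s, ⟨hs1, hs2⟩, hs3⟩ := (hback.and self_mem_nhdsWithin).exists
  have hXp : X p.1 p.2 s ∈ P.ω := by rwa [hp2, h.restart]
  have hc : Continuous fun q : ℝ × State d => X q.1 q.2 s :=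
    h.continuous_flow.comp (continuous_id.prodMk continuous_const)
  have h1 : ∀ᶠ q : ℝ × State d in 𝓝 p, X q.1 q.2 s ∈ P.ω :=
    hc.continuousAt.eventually (P.isOpen_ω.mem_nhds hXp)
  have h2 : ∀ᶠ q : ℝ × State d in 𝓝 p, q.1 ∈ Ioo s P.T :=
    continuous_fst.continuousAt.eventually (Ioo_mem_nhds (lt_of_lt_of_le hs3 htp.1) htp.2)
  filter_upwards [h1, h2] with q hq1 hq2
  refine (h.mem_G_iff hv hχ).2 ⟨s, hs2, _, hq1, Ioo_subset_Ico_self hq2, ?_⟩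
  rw [h.restart, h.isFlow.init]

theorem 𝒱_eq_of_mem_stays (h : P.IsCutFlow χ v X) {S : Set (State d)} (hχ : ∀ x ∈ S, χ x = 1)
    {p : ℝ × State d} (hp : p ∈ P.Stays X S) : P.𝒱 v p.1 p.2 = P.cutValue χ v X p :=
  h.𝒱_eq_cutValue hp.1 fun t ht => hχ _ (hp.2 t ht)

end IsCutFlow

end Problem

/-! ### The derivative of the cost with respect to the feedback -/

/-- The derivative at `0` of `s ↦ J₀ + s ∫ m(s,t,y_s(t)) dt` is the integral of `m(0,t,x(t))`, if
`m` is continuous and `y_s → x` uniformly. -/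
theorem hasDerivAt_of_eq_add_mul_integral {E : Type*} [NormedAddCommGroup E]
    {m : ℝ × (ℝ × E) → ℝ} (hm : Continuous m) {x : ℝ → E} (hx : Continuous x) {y : ℝ → ℝ → E}
    (hy : ∀ s, Continuous (y s)) {a b C : ℝ} (hab : a ≤ b)
    (hyx : ∀ s, ∀ t ∈ Icc a b, ‖y s t - x t‖ ≤ C * |s|) {J : ℝ → ℝ} {J₀ : ℝ}
    (hJ : ∀ᶠ s in 𝓝 0, J s = J₀ + s * ∫ t in a..b, m (s, t, y s t)) :
    HasDerivAt J (∫ t in a..b, m (0, t, x t)) 0 := by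
  have h0 : J 0 = J₀ := by simpa using hJ.self_of_nhds
  have hlim : Tendsto (fun s => ∫ t in a..b, m (s, t, y s t)) (𝓝 0)
      (𝓝 (∫ t in a..b, m (0, t, x t))) := by
    rw [Metric.tendsto_nhds]
    intro ε hε
    have hη : 0 < ε / (b - a + 1) := div_pos hε (by linarith)
    have h1 : ∀ᶠ q : ℝ × E in 𝓝 (0, 0), ∀ t ∈ Icc a b,
        |m (q.1, t, x t + q.2) - m (0, t, x t)| < ε / (b - a + 1) := by
      refine isCompact_Icc.eventually_forall_of_forall_eventually fun t _ => ?_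
      have hc : Continuous fun z : (ℝ × E) × ℝ =>
          |m (z.1.1, z.2, x z.2 + z.1.2) - m (0, z.2, x z.2)| := by fun_prop
      exact hc.continuousAt.eventually_lt continuousAt_const (by simpa using hη)
    obtain ⟨δ, hδ, hball⟩ := Metric.eventually_nhds_iff_ball.1 h1
    have h2 : ∀ᶠ s : ℝ in 𝓝 0, |s| < δ ∧ C * |s| < δ := by
      refine Filter.Eventually.and ?_ ?_
      · exact (continuous_abs.continuousAt).eventually_lt continuousAt_const (by simpa using hδ)
      · exact (show Continuous fun s : ℝ => C * |s| by fun_prop).continuousAt.eventually_lt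
          continuousAt_const (by simpa using hδ)
    filter_upwards [h2] with s hs
    have hys := hy s
    rw [dist_eq_norm, ← intervalIntegral.integral_sub
      (Continuous.intervalIntegrable (by fun_prop) _ _)
      (Continuous.intervalIntegrable (by fun_prop) _ _)]
    refine (intervalIntegral.norm_integral_le_of_norm_le_const
      (C := ε / (b - a + 1)) fun t ht => ?_).trans_lt ?_
    · rw [uIoc_of_le hab] at ht
      have ht' := Ioc_subset_Icc_self ht
      have := hball (s, y s t - x t) (by
        rw [← ball_prod_same, mem_prod, mem_ball_zero_iff, mem_ball_zero_iff]
        exact ⟨hs.1, (hyx s t ht').trans_lt hs.2⟩) t ht'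
      rw [Real.norm_eq_abs]
      simpa using this.le
    · rw [abs_of_nonneg (by linarith), div_mul_eq_mul_div, div_lt_iff₀ (by linarith)]
      nlinarith
  rw [hasDerivAt_iff_tendsto_slope_zero]
  refine (hlim.mono_left nhdsWithin_le_nhds).congr' ?_
  filter_upwards [hJ.filter_mono nhdsWithin_le_nhds, self_mem_nhdsWithin] with s hs hs0
  have hs0' : s ≠ 0 := hs0
  rw [zero_add, hs, h0, smul_eq_mul]
  field_simp
  ring

namespace Problem

variable {d M : ℕ} (P : Problem d M) {v φ : ℝ → State d → ℝ}

/-- The field `Bᵀ∇_y W + β U_v`, where `W` is the cost of the cut-off flow. It vanishes where the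
feedback `U_v` is the minimiser in the Hamilton-Jacobi-Bellman equation for `W`. -/
noncomputable def residual (χ : State d → ℝ) (v : ℝ → State d → ℝ)
    (X : ℝ → State d → ℝ → State d) (p : ℝ × State d) : Ctrl M :=
  ContinuousLinearMap.adjoint P.B (riesz (State d)
    ((fderiv ℝ (P.cutValue χ v X) p).comp (ContinuousLinearMap.inr ℝ ℝ (State d)))) +
  P.β • cutExt P.T χ (P.U v) p.1 p.2

theorem inner_residual (χ : State d → ℝ) (X : ℝ → State d → ℝ → State d) (p : ℝ × State d)
    (u : Ctrl M) : inner ℝ (P.residual χ v X p) u =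
      fderiv ℝ (P.cutValue χ v X) p (0, P.B u) +
        P.β * inner ℝ (cutExt P.T χ (P.U v) p.1 p.2) u := by
  rw [residual, inner_add_left, ContinuousLinearMap.adjoint_inner_left, inner_riesz,
    inner_smul_left]
  simp

namespace IsCutFlow

variable {P} {χ : State d → ℝ} {X : ℝ → State d → ℝ → State d}

theorem continuous_residual (h : P.IsCutFlow χ v X) : Continuous (P.residual χ v X) := by
  have h1 := h.contDiff_cutValue.continuous_fderiv one_ne_zero
  have h2 := h.continuous_cutExt_U h.memCk
  unfold residual
  fun_prop

theorem cutExt_U_add_smul (h : P.IsCutFlow χ v X) (hφ : MemCk P.T (closure P.Ω) 2 φ) (s t : ℝ)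
    (y : State d) : cutExt P.T χ (P.U (v + s • φ)) t y =
      cutExt P.T χ (P.U v) t y + s • cutExt P.T χ (P.U φ) t y := by
  by_cases hy : y ∈ tsupport χ
  · simp only [cutExt]
    rw [P.U_add_smul h.memCk hφ s (clamp_mem P.T_pos.le t)
      (subset_closure (h.tsupport_subset hy)), smul_add, smul_comm]
  · simp [cutExt, image_eq_zero_of_notMem_tsupport hy]

theorem cutExt_field_add_smul (h : P.IsCutFlow χ v X) (hφ : MemCk P.T (closure P.Ω) 2 φ)
    (s t : ℝ) (y : State d) : cutExt P.T χ (P.field (v + s • φ)) t y =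
      cutExt P.T χ (P.field v) t y + s • P.B (cutExt P.T χ (P.U φ) t y) := by
  have h1 : ∀ w, cutExt P.T χ (P.field w) t y =
      cutExt P.T χ P.f t y + P.B (cutExt P.T χ (P.U w) t y) := fun w => by
    simp [cutExt, field, smul_add]
  rw [h1, h1, h.cutExt_U_add_smul hφ, map_add, map_smul, add_assoc]

theorem cutExt_running_add_smul (h : P.IsCutFlow χ v X) (hφ : MemCk P.T (closure P.Ω) 2 φ)
    (s t : ℝ) {y : State d} (hy : χ y = 1) : cutExt P.T χ (P.running (v + s • φ)) t y =
      cutExt P.T χ (P.running v) t y +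
        s * (P.β * inner ℝ (cutExt P.T χ (P.U v) t y) (cutExt P.T χ (P.U φ) t y) +
          s * (P.β / 2 * ‖cutExt P.T χ (P.U φ) t y‖ ^ 2)) := by
  have h1 : ∀ w, cutExt P.T χ (P.running w) t y =
      cutExt P.T χ P.ℓ t y + P.β / 2 * ‖cutExt P.T χ (P.U w) t y‖ ^ 2 := fun w => by
    simp [cutExt, running, hy]
  rw [h1, h1, h.cutExt_U_add_smul hφ, norm_add_sq_real, inner_smul_right, norm_smul, mul_pow,
    Real.norm_eq_abs, sq_abs]
  ring

/-- The derivative of the cost with respect to the feedback. It needs no linearised state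
equation: the cost of the perturbed trajectory is compared with `W` by the transport equation
that `W` satisfies. -/
theorem hasDerivAt_𝒱 (h : P.IsCutFlow χ v X) (hφ : MemCk P.T (closure P.Ω) 2 φ)
    {S : Set (State d)} {δ : ℝ} (hδ : 0 < δ) (hχ : ∀ x ∈ S, ∀ y, ‖y - x‖ < δ → χ y = 1)
    {p : ℝ × State d} (hp : p ∈ P.Stays X S) :
    HasDerivAt (fun s : ℝ => P.𝒱 (v + s • φ) p.1 p.2)
      (∫ t in p.1..P.T, inner ℝ (P.residual χ v X (t, X p.1 p.2 t))
        (cutExt P.T χ (P.U φ) t (X p.1 p.2 t))) 0 := by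
  obtain ⟨F', K, hF⟩ := h.exists_isC1Bounded_field
  obtain ⟨L', K', hL⟩ := h.exists_isC1Bounded_running
  have hex : ∀ s : ℝ, ∃ Y, P.IsCutFlow χ (v + s • φ) Y := fun s =>
    P.exists_isCutFlow (h.memCk.add_smul P.uniqueDiffOn_closure_Ω hφ s) h.contDiff
      h.hasCompactSupport h.tsupport_subset
  choose Y hY using hex
  have hUφ := h.continuous_cutExt_U hφ
  have hUv := h.continuous_cutExt_U h.memCk
  obtain ⟨C, hC⟩ := exists_bound_cutExt P.T_pos.le h.hasCompactSupport hUφ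
  have hC0 : 0 ≤ C := (norm_nonneg _).trans (hC 0 0)
  have hZ := h.continuous_residual
  have hW := h.contDiff_cutValue
  have hpT := hp.1.2
  have hXc := (h.isFlow.curve p.1 p.2).continuous
  have hYc : ∀ s, Continuous (Y s p.1 p.2) := fun s => ((hY s).isFlow.curve p.1 p.2).continuous
  have hYd : ∀ s t, HasDerivAt (Y s p.1 p.2) (cutExt P.T χ (P.field v) t (Y s p.1 p.2 t) +
      s • P.B (cutExt P.T χ (P.U φ) t (Y s p.1 p.2 t))) t := fun s t => by
    rw [← h.cutExt_field_add_smul hφ]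
    exact (hY s).isFlow.curve p.1 p.2 t
  set D : ℝ := ‖P.B‖ * C * (P.T - p.1) * Real.exp (K * (P.T - p.1)) with hD
  -- the perturbation `s B U_φ` moves the trajectory by at most `D |s|`
  have hclose : ∀ s, ∀ t ∈ Icc p.1 P.T, ‖Y s p.1 p.2 t - X p.1 p.2 t‖ ≤ D * |s| := by
    intro s t ht
    have := norm_sub_le_of_approx hF.lipschitzWith (h.isFlow.curve p.1 p.2) (hYd s) (s := p.1)
      (t := t) (ε := |s| * (‖P.B‖ * C)) (by positivity) (fun τ _ => by
        rw [add_sub_cancel_left, norm_smul, Real.norm_eq_abs]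
        gcongr
        exact (P.B.le_opNorm _).trans (by gcongr; exact hC _ _))
    rw [h.isFlow.init, (hY s).isFlow.init, sub_self, norm_zero, zero_add,
      abs_of_nonneg (sub_nonneg.2 ht.1)] at this
    rw [norm_sub_rev]
    refine this.trans ?_
    have htT : t - p.1 ≤ P.T - p.1 := by linarith [ht.2]
    have ht0 : 0 ≤ t - p.1 := sub_nonneg.2 ht.1
    calc |s| * (‖P.B‖ * C) * (t - p.1) * Real.exp (K * (t - p.1))
        ≤ |s| * (‖P.B‖ * C) * (P.T - p.1) * Real.exp (K * (P.T - p.1)) := by gcongr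
      _ = D * |s| := by rw [hD]; ring
  have hsmall : ∀ᶠ s in 𝓝 (0 : ℝ), D * |s| < δ :=
    (show Continuous fun s : ℝ => D * |s| by fun_prop).continuousAt.eventually_lt
      continuousAt_const (by simpa using hδ)
  have hcm : Continuous fun q : ℝ × (ℝ × State d) =>
      inner ℝ (P.residual χ v X q.2) (cutExt P.T χ (P.U φ) q.2.1 q.2.2) +
        q.1 * (P.β / 2 * ‖cutExt P.T χ (P.U φ) q.2.1 q.2.2‖ ^ 2) := by
    have h1 : Continuous fun q : ℝ × (ℝ × State d) => cutExt P.T χ (P.U φ) q.2.1 q.2.2 :=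
      hUφ.comp continuous_snd
    have h2 : Continuous fun q : ℝ × (ℝ × State d) => P.residual χ v X q.2 :=
      hZ.comp continuous_snd
    fun_prop
  have hmain := hasDerivAt_of_eq_add_mul_integral hcm hXc hYc hpT hclose
    (J := fun s : ℝ => P.𝒱 (v + s • φ) p.1 p.2) (J₀ := P.cutValue χ v X p) ?_
  · simpa using hmain
  filter_upwards [hsmall] with s hs
  have hone : ∀ t ∈ Icc p.1 P.T, χ (Y s p.1 p.2 t) = 1 := fun t ht =>
    hχ _ (hp.2 t ht) _ ((hclose s t ht).trans_lt hs)
  rw [(hY s).𝒱_eq_cutValue hp.1 hone]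
  have hty : Continuous fun t => (t, Y s p.1 p.2 t) := continuous_id.prodMk (hYc s)
  have hcUφ : Continuous fun t => cutExt P.T χ (P.U φ) t (Y s p.1 p.2 t) := hUφ.comp hty
  have hcUv : Continuous fun t => cutExt P.T χ (P.U v) t (Y s p.1 p.2 t) := hUv.comp hty
  have hcF : Continuous fun t => cutExt P.T χ (P.field v) t (Y s p.1 p.2 t) :=
    hF.continuous.comp hty
  have hcL : Continuous fun t => cutExt P.T χ (P.running v) t (Y s p.1 p.2 t) :=
    hL.continuous.comp hty
  have hcD : Continuous fun t => fderiv ℝ (P.cutValue χ v X) (t, Y s p.1 p.2 t) :=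
    (hW.continuous_fderiv one_ne_zero).comp hty
  -- the unperturbed cost functional along the perturbed trajectory
  have hcost := integral_add_eq_value_add h.isFlow hF hL h.contDiff_terminal hpT
    (hYc s).continuousOn (fun t _ => hYd s t) (Continuous.continuousOn (by fun_prop))
  simp only [add_sub_cancel_left, (hY s).isFlow.init] at hcost
  have hL_s : ∫ t in p.1..P.T, cutExt P.T χ (P.running (v + s • φ)) t (Y s p.1 p.2 t) =
      (∫ t in p.1..P.T, cutExt P.T χ (P.running v) t (Y s p.1 p.2 t)) +
      ∫ t in p.1..P.T, s * (P.β * inner ℝ (cutExt P.T χ (P.U v) t (Y s p.1 p.2 t))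
        (cutExt P.T χ (P.U φ) t (Y s p.1 p.2 t)) +
          s * (P.β / 2 * ‖cutExt P.T χ (P.U φ) t (Y s p.1 p.2 t)‖ ^ 2)) := by
    rw [← intervalIntegral.integral_add (Continuous.intervalIntegrable (by fun_prop) _ _)
      (Continuous.intervalIntegrable (by fun_prop) _ _)]
    refine intervalIntegral.integral_congr fun t ht => ?_
    rw [uIcc_of_le hpT] at ht
    exact h.cutExt_running_add_smul hφ s t (hone t ht)
  have hfin : (s * ∫ t in p.1..P.T,
      (inner ℝ (P.residual χ v X (t, Y s p.1 p.2 t)) (cutExt P.T χ (P.U φ) t (Y s p.1 p.2 t)) +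
        s * (P.β / 2 * ‖cutExt P.T χ (P.U φ) t (Y s p.1 p.2 t)‖ ^ 2))) =
      (∫ t in p.1..P.T, fderiv ℝ (P.cutValue χ v X) (t, Y s p.1 p.2 t)
        (0, s • P.B (cutExt P.T χ (P.U φ) t (Y s p.1 p.2 t)))) +
      ∫ t in p.1..P.T, s * (P.β * inner ℝ (cutExt P.T χ (P.U v) t (Y s p.1 p.2 t))
        (cutExt P.T χ (P.U φ) t (Y s p.1 p.2 t)) +
          s * (P.β / 2 * ‖cutExt P.T χ (P.U φ) t (Y s p.1 p.2 t)‖ ^ 2)) := by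
    rw [← intervalIntegral.integral_add (Continuous.intervalIntegrable (by fun_prop) _ _)
      (Continuous.intervalIntegrable (by fun_prop) _ _), ← intervalIntegral.integral_const_mul]
    refine intervalIntegral.integral_congr fun t _ => ?_
    have h1 : ((0, s • P.B (cutExt P.T χ (P.U φ) t (Y s p.1 p.2 t))) : ℝ × State d) =
        s • (0, P.B (cutExt P.T χ (P.U φ) t (Y s p.1 p.2 t))) := by simp
    simp only [inner_residual, h1, map_smul, smul_eq_mul]
    ring
  have e1 : P.cutValue χ (v + s • φ) (Y s) (p.1, p.2) =
      (∫ t in p.1..P.T, cutExt P.T χ (P.running (v + s • φ)) t (Y s p.1 p.2 t)) +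
        cutExt P.T χ (fun _ => P.g) 0 (Y s p.1 p.2 P.T) := rfl
  have e2 : P.cutValue χ v X p = value X (cutExt P.T χ (P.running v))
    (cutExt P.T χ (fun _ => P.g) 0) P.T (p.1, p.2) := rfl
  rw [e1, hL_s, hfin, e2]
  have e3 : ∀ t, fderiv ℝ (P.cutValue χ v X) t = fderiv ℝ (value X (cutExt P.T χ (P.running v))
    (cutExt P.T χ (fun _ => P.g) 0) P.T) t := fun t => rfl
  simp only [e3]
  linarith

end IsCutFlow

end Problem

/-! ### The necessary condition -/

theorem eq_zero_of_intervalIntegral_eq_zero {f : ℝ → ℝ} {a b : ℝ} (hab : a < b)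
    (hf : Continuous f) (h0 : ∀ t ∈ Icc a b, 0 ≤ f t) (hi : ∫ t in a..b, f t = 0) :
    ∀ t ∈ Icc a b, f t = 0 := by
  by_contra! hne
  obtain ⟨t, ht, hft⟩ := hne
  have := intervalIntegral.integral_pos hab hf.continuousOn
    (fun t ht => h0 t (Ioc_subset_Icc_self ht)) ⟨t, ht, (h0 t ht).lt_of_ne' hft⟩
  exact this.ne' hi

theorem continuous_integral_to {X : Type*} [TopologicalSpace X]
    [FirstCountableTopology X] [LocallyCompactSpace X] {f : X → ℝ → ℝ} {a : X → ℝ}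
    (hf : Continuous (Function.uncurry f)) (ha : Continuous a) (T : ℝ) :
    Continuous fun x => ∫ t in a x..T, f x t := by
  have h1 := intervalIntegral.continuous_parametric_intervalIntegral_of_continuous
    (μ := volume) (a₀ := T) hf ha
  exact h1.neg.congr fun x => (intervalIntegral.integral_symm T (a x)).symm

namespace Problem

variable {d M : ℕ} (P : Problem d M) {v φ : ℝ → State d → ℝ}

theorem isCompact_closure_R (hv : v ∈ P.D) : IsCompact (closure (P.R v)) :=
  P.isCompact_closure_Ω.of_isClosed_subset isClosed_closure (hv.2.2.trans subset_closure)

/-- The integral of `k` over the trajectory of `X` that starts at the datum `q`. -/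
noncomputable def pathIntegral (X : ℝ → State d → ℝ → State d) (k : ℝ × State d → ℝ)
    (q : ℝ × State d) : ℝ := ∫ t in q.1..P.T, k (t, X q.1 q.2 t)

/-- The integral of `k` over all trajectories of `X` that start in `(0,T) × ω`. -/
noncomputable def totalIntegral (X : ℝ → State d → ℝ → State d) (k : ℝ × State d → ℝ) : ℝ :=
  ∫ y₀ in P.ω, (∫ t₀ in (0 : ℝ)..P.T, P.pathIntegral X k (t₀, y₀))

theorem volume_ω_lt_top : volume P.ω < ⊤ :=
  (P.bounded_Ω.subset (subset_closure.trans P.closure_ω_subset)).measure_lt_top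

theorem integrableOn_ω {k : State d → ℝ} (hk : Continuous k) : IntegrableOn k P.ω :=
  (hk.continuousOn.integrableOn_compact (P.bounded_Ω.subset
    (subset_closure.trans P.closure_ω_subset)).isCompact_closure).mono_set subset_closure

namespace IsCutFlow

variable {P} {χ : State d → ℝ} {X : ℝ → State d → ℝ → State d}

/-- The difference `W - v` has directions `φ ∈ C([0,T]; C²)` close to it in `C([0,T]; C¹)`; in
such a direction, the density of the derivative of the cost is close to `-|Bᵀ∇(W - v)|²/β`. -/
theorem exists_direction (h : P.IsCutFlow χ v X) {S : Set (State d)} (hS : IsCompact S) {δ : ℝ}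
    (hδ : 0 < δ) (hχ : ∀ x ∈ S, ∀ y, ‖y - x‖ < δ → χ y = 1) {ε : ℝ} (hε : 0 < ε) :
    ∃ φ, MemCk P.T (closure P.Ω) 2 φ ∧ ∀ t ∈ Icc 0 P.T, ∀ y ∈ S,
      |‖P.residual χ v X (t, y)‖ ^ 2 + P.β *
        inner ℝ (P.residual χ v X (t, y)) (cutExt P.T χ (P.U φ) t y)| ≤ ε := by
  have hβ := P.β_pos
  have hSχ : ∀ y ∈ S, χ y = 1 := fun y hy => hχ y hy y (by simpa using hδ)
  have hW := h.contDiff_cutValue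
  set A : (State d →L[ℝ] ℝ) →L[ℝ] Ctrl M :=
    (ContinuousLinearMap.adjoint P.B).comp (riesz (State d)) with hA
  obtain ⟨C, hC⟩ := ((isCompact_Icc (a := 0) (b := P.T)).prod hS).exists_bound_of_continuousOn
    h.continuous_residual.continuousOn
  set η : ℝ := ε / (|C| * ‖A‖ + 1) with hη
  have hη0 : 0 < η := by positivity
  -- the extension of `W - v` and its mollification
  have hv1 : MemCk P.T (closure P.Ω) 1 v :=
    ⟨fun t ht => (h.memCk.1 t ht).of_le (by norm_cast), fun j hj => h.memCk.2 j (by omega)⟩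
  have hvC := hv1.isC1On P.isOpen_Ω P.uniqueDiffOn_closure_Ω
  have hWC : IsC1On P.T P.Ω (fun t y => P.cutValue χ v X (t, y))
      (fun p => (fderiv ℝ (P.cutValue χ v X) p).comp
        (ContinuousLinearMap.inr ℝ ℝ (State d))) := by
    refine ⟨hW.continuous.continuousOn, Continuous.continuousOn ?_, fun t _ y _ => ?_⟩
    · have := hW.continuous_fderiv one_ne_zero
      fun_prop
    · exact ((hW.differentiable one_ne_zero) (t, y)).hasFDerivAt.comp y
        (hasFDerivAt_prodMk_right t y)
  have hψ := hWC.add (hvC.clm_comp (-ContinuousLinearMap.id ℝ ℝ))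
  obtain ⟨K, hK⟩ := hψ.exists_isC1Bounded_cutExt P.T_pos.le P.isOpen_Ω h.contDiff
    h.hasCompactSupport h.tsupport_subset
  obtain ⟨φ, hφ, hφψ⟩ := exists_memCk_two_approx hK.continuous hK.hasFDerivAt hK.continuous_deriv
    h.hasCompactSupport (fun t y hy => by
      simp [cutExt, image_eq_zero_of_notMem_tsupport hy])
    P.isCompact_closure_Ω P.uniqueDiffOn_closure_Ω P.T hη0
  refine ⟨φ, hφ, fun t ht y hy => ?_⟩
  have hyΩ : y ∈ P.Ω := h.mem_Ω_of_eq_one (hSχ y hy)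
  have hyn : closure P.Ω ∈ 𝓝 y := mem_of_superset (P.isOpen_Ω.mem_nhds hyΩ) subset_closure
  have hχ' : fderiv ℝ χ y = 0 := by
    have : χ =ᶠ[𝓝 y] fun _ => 1 := by
      filter_upwards [ball_mem_nhds y hδ] with z hz
      exact hχ y hy z (by simpa [dist_eq_norm] using hz)
    rw [this.fderiv_eq]; simp
  have happ := hφψ t ht y (subset_closure hyΩ)
  set a := fderiv ℝ (φ t) y with ha
  set b : State d →L[ℝ] ℝ := (fderiv ℝ (P.cutValue χ v X) (t, y)).comp
    (ContinuousLinearMap.inr ℝ ℝ (State d)) - fderivWithin ℝ (v t) (closure P.Ω) y with hb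
  have happ' : ‖a - b‖ ≤ η := by
    have hone := hSχ y hy
    have e : cutExtDeriv P.T χ (fun t y => P.cutValue χ v X (t, y) +
        (-ContinuousLinearMap.id ℝ ℝ) (v t y)) (fun p => (fderiv ℝ (P.cutValue χ v X) p).comp
          (ContinuousLinearMap.inr ℝ ℝ (State d)) + (-ContinuousLinearMap.id ℝ ℝ).comp
          (fderivWithin ℝ (v p.1) (closure P.Ω) p.2)) (t, y) = b := by
      ext x
      simp [cutExtDeriv, hone, hχ', clamp_of_mem ht, hb, sub_eq_add_neg]
    rw [← e]
    exact happ
  set z := P.residual χ v X (t, y) with hz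
  have hzb : z = A b := by
    rw [hz, residual, cutExt_of_eq_one _ ht (hSχ y hy), U_eq, hb, hA]
    simp only [map_sub, smul_apply, ContinuousLinearMap.comp_apply]
    rw [smul_smul, mul_neg, mul_one_div_cancel hβ.ne', neg_one_smul, sub_eq_add_neg]
  have hU : cutExt P.T χ (P.U φ) t y = -(1 / P.β) • A a := by
    rw [cutExt_of_eq_one _ ht (hSχ y hy), U_eq, fderivWithin_of_mem_nhds hyn]
    rfl
  have hcalc : ‖z‖ ^ 2 + P.β * inner ℝ z (cutExt P.T χ (P.U φ) t y) = -inner ℝ z (A (a - b)) := by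
    rw [hU, inner_smul_right, map_sub, inner_sub_right, ← hzb, real_inner_self_eq_norm_sq]
    field_simp
    ring
  rw [hcalc, abs_neg]
  have hzC : ‖z‖ ≤ |C| := (hC (t, y) ⟨ht, hy⟩).trans (le_abs_self C)
  calc |inner ℝ z (A (a - b))| ≤ ‖z‖ * ‖A (a - b)‖ := abs_real_inner_le_norm _ _
    _ ≤ |C| * (‖A‖ * η) := by
        gcongr
        exact (A.le_opNorm _).trans (by gcongr)
    _ ≤ (|C| * ‖A‖ + 1) * η := by nlinarith
    _ = ε := by rw [hη]; field_simp

theorem continuous_pathIntegral (h : P.IsCutFlow χ v X) {k : ℝ × State d → ℝ}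
    (hk : Continuous k) : Continuous (P.pathIntegral X k) :=
  continuous_integral_to (f := fun q t => k (t, X q.1 q.2 t))
    (hk.comp (continuous_snd.prodMk h.continuous_flow)) continuous_fst P.T

theorem continuous_integral_pathIntegral (h : P.IsCutFlow χ v X) {k : ℝ × State d → ℝ}
    (hk : Continuous k) :
    Continuous fun y₀ => ∫ t₀ in (0 : ℝ)..P.T, P.pathIntegral X k (t₀, y₀) :=
  continuous_integral_to (f := fun y₀ t₀ => P.pathIntegral X k (t₀, y₀))
    ((h.continuous_pathIntegral hk).comp continuous_swap) continuous_const P.T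

theorem mem_stays_of_mem_ω (h : P.IsCutFlow χ v X) (hv : v ∈ P.D)
    (hχ : ∀ x ∈ closure (P.R v), χ x = 1) {t₀ : ℝ} (ht₀ : t₀ ∈ Ioo 0 P.T) {y₀ : State d}
    (hy₀ : y₀ ∈ P.ω) : (t₀, y₀) ∈ P.Stays X (closure (P.R v)) :=
  ⟨Ioo_subset_Icc_self ht₀, (h.stays_of_mem_ω hv hχ ht₀ hy₀).2⟩

theorem continuous_along (h : P.IsCutFlow χ v X) {k : ℝ × State d → ℝ} (hk : Continuous k)
    (s : ℝ) (x : State d) : Continuous fun t => k (t, X s x t) := by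
  have := (h.isFlow.curve s x).continuous
  fun_prop

theorem totalIntegral_add_mul (h : P.IsCutFlow χ v X) {k l : ℝ × State d → ℝ} (hk : Continuous k)
    (hl : Continuous l) (c : ℝ) : P.totalIntegral X (fun q => k q + c * l q) =
      P.totalIntegral X k + c * P.totalIntegral X l := by
  have h1 : ∀ q, P.pathIntegral X (fun q => k q + c * l q) q =
      P.pathIntegral X k q + c * P.pathIntegral X l q := fun q => by
    have hk' := h.continuous_along hk q.1 q.2
    have hl' := h.continuous_along hl q.1 q.2
    simp only [pathIntegral]
    rw [intervalIntegral.integral_add (hk'.intervalIntegrable _ _)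
      ((hl'.intervalIntegrable _ _).const_mul c), intervalIntegral.integral_const_mul]
  have hkp := h.continuous_pathIntegral hk
  have hlp := h.continuous_pathIntegral hl
  have h2 : ∀ y₀, (∫ t₀ in (0 : ℝ)..P.T, P.pathIntegral X (fun q => k q + c * l q) (t₀, y₀)) =
      (∫ t₀ in (0 : ℝ)..P.T, P.pathIntegral X k (t₀, y₀)) +
        c * ∫ t₀ in (0 : ℝ)..P.T, P.pathIntegral X l (t₀, y₀) := fun y₀ => by
    simp only [h1]
    rw [intervalIntegral.integral_add (Continuous.intervalIntegrable (by fun_prop) _ _)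
      (Continuous.intervalIntegrable (by fun_prop) _ _), intervalIntegral.integral_const_mul]
  simp only [totalIntegral, h2]
  rw [integral_add (P.integrableOn_ω (h.continuous_integral_pathIntegral hk))
    ((P.integrableOn_ω (h.continuous_integral_pathIntegral hl)).const_mul _), integral_const_mul]

theorem abs_totalIntegral_le (h : P.IsCutFlow χ v X) (hv : v ∈ P.D)
    (hχ : ∀ x ∈ closure (P.R v), χ x = 1) {k : ℝ × State d → ℝ} {ε : ℝ} (hε : 0 ≤ ε)
    (hkε : ∀ t ∈ Icc 0 P.T, ∀ y ∈ closure (P.R v), |k (t, y)| ≤ ε) :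
    |P.totalIntegral X k| ≤ ε * (P.T * P.T * volume.real P.ω) := by
  have hT := P.T_pos
  have h1 : ∀ t₀ ∈ Ioo 0 P.T, ∀ y₀ ∈ P.ω, ‖P.pathIntegral X k (t₀, y₀)‖ ≤ ε * P.T := by
    intro t₀ ht₀ y₀ hy₀
    have hst := h.mem_stays_of_mem_ω hv hχ ht₀ hy₀
    refine (intervalIntegral.norm_integral_le_of_norm_le_const (C := ε) fun t ht => ?_).trans ?_
    · simp only [uIoc_of_le ht₀.2.le] at ht
      exact hkε t ⟨ht₀.1.le.trans ht.1.le, ht.2⟩ _ (hst.2 t (Ioc_subset_Icc_self ht))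
    · rw [abs_of_nonneg (by simpa using ht₀.2.le)]
      gcongr
      simpa using ht₀.1.le
  have h2 : ∀ y₀ ∈ P.ω, ‖∫ t₀ in (0 : ℝ)..P.T, P.pathIntegral X k (t₀, y₀)‖ ≤ ε * P.T * P.T := by
    intro y₀ hy₀
    rw [intervalIntegral.integral_of_le hT.le, integral_Ioc_eq_integral_Ioo]
    refine (norm_setIntegral_le_of_norm_le_const (by simp)
      fun t₀ ht₀ => h1 t₀ ht₀ y₀ hy₀).trans ?_
    simp [hT.le]
  exact (norm_setIntegral_le_of_norm_le_const P.volume_ω_lt_top h2).trans (le_of_eq (by ring))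

theorem eq_zero_of_totalIntegral_eq_zero (h : P.IsCutFlow χ v X) (hv : v ∈ P.D)
    (hχ : ∀ x ∈ closure (P.R v), χ x = 1) {k : ℝ × State d → ℝ} (hk : Continuous k)
    (hk0 : ∀ q, 0 ≤ k q) (hint : P.totalIntegral X k = 0) {p : ℝ × State d} (hp : p ∈ P.G v) :
    k p = 0 := by
  have hT := P.T_pos
  have hkp := h.continuous_pathIntegral hk
  have hN0 : ∀ t₀ ∈ Icc 0 P.T, ∀ y₀, 0 ≤ P.pathIntegral X k (t₀, y₀) := fun t₀ ht₀ y₀ =>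
    intervalIntegral.integral_nonneg ht₀.2 fun t _ => hk0 _
  have hHc := h.continuous_integral_pathIntegral hk
  have hHzero : EqOn (fun y₀ => ∫ t₀ in (0 : ℝ)..P.T, P.pathIntegral X k (t₀, y₀)) 0 P.ω := by
    have hH0 : ∀ y₀, 0 ≤ ∫ t₀ in (0 : ℝ)..P.T, P.pathIntegral X k (t₀, y₀) := fun y₀ =>
      intervalIntegral.integral_nonneg hT.le fun t ht => hN0 t ht y₀
    have := (setIntegral_eq_zero_iff_of_nonneg_ae (.of_forall hH0) (P.integrableOn_ω hHc)).1 hint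
    exact Measure.eqOn_open_of_ae_eq this P.isOpen_ω hHc.continuousOn continuousOn_const
  obtain ⟨t₀, ht₀, y₀, hy₀, htp, hp2⟩ := (h.mem_G_iff hv hχ).1 hp
  have hNz : P.pathIntegral X k (t₀, y₀) = 0 := eq_zero_of_intervalIntegral_eq_zero hT
    (f := fun t => P.pathIntegral X k (t, y₀)) (by fun_prop) (fun t ht => hN0 t ht y₀)
    (hHzero hy₀) t₀ (Ioo_subset_Icc_self ht₀)
  have := eq_zero_of_intervalIntegral_eq_zero ht₀.2 (h.continuous_along hk t₀ y₀)
    (fun t _ => hk0 _) hNz p.1 (Ico_subset_Icc_self htp)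
  rwa [← hp2] at this

theorem totalIntegral_eq_zero (h : P.IsCutFlow χ v X) (hv : v ∈ P.D) {δ : ℝ} (hδ : 0 < δ)
    (hχ : ∀ x ∈ closure (P.R v), ∀ y, ‖y - x‖ < δ → χ y = 1) (hnec : P.NecessaryCondition v)
    (hφ : MemCk P.T (closure P.Ω) 2 φ) : P.totalIntegral X (fun q =>
      inner ℝ (P.residual χ v X q) (cutExt P.T χ (P.U φ) q.1 q.2)) = 0 := by
  have hT := P.T_pos
  have hχ1 : ∀ x ∈ closure (P.R v), χ x = 1 := fun x hx => hχ x hx x (by simpa using hδ)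
  rw [← hnec φ hφ]
  refine setIntegral_congr_fun P.isOpen_ω.measurableSet fun y₀ hy₀ => ?_
  rw [intervalIntegral.integral_of_le hT.le, intervalIntegral.integral_of_le hT.le,
    integral_Ioc_eq_integral_Ioo, integral_Ioc_eq_integral_Ioo]
  refine setIntegral_congr_fun measurableSet_Ioo fun t₀ ht₀ => ?_
  exact (h.hasDerivAt_𝒱 hφ hδ hχ (h.mem_stays_of_mem_ω hv hχ1 ht₀ hy₀)).deriv.symm

/-- The necessary condition makes the residual vanish on the reached set: with `W - v` as
direction, it says that the integral of `|Bᵀ∇(W - v)|²` over all trajectories is zero. -/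
theorem residual_eq_zero (h : P.IsCutFlow χ v X) (hv : v ∈ P.D) {δ : ℝ} (hδ : 0 < δ)
    (hχ : ∀ x ∈ closure (P.R v), ∀ y, ‖y - x‖ < δ → χ y = 1) (hnec : P.NecessaryCondition v)
    {p : ℝ × State d} (hp : p ∈ P.G v) : P.residual χ v X p = 0 := by
  have hT := P.T_pos
  have hχ1 : ∀ x ∈ closure (P.R v), χ x = 1 := fun x hx => hχ x hx x (by simpa using hδ)
  have hZ := h.continuous_residual
  have hZ2 : Continuous fun q => ‖P.residual χ v X q‖ ^ 2 := hZ.norm.pow 2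
  have hsmall : ∀ ε > 0, |P.totalIntegral X (fun q => ‖P.residual χ v X q‖ ^ 2)| ≤
      ε * (P.T * P.T * volume.real P.ω) := by
    intro ε hε
    obtain ⟨φ, hφ, hφε⟩ := h.exists_direction (P.isCompact_closure_R hv) hδ hχ hε
    have h1 := h.totalIntegral_add_mul hZ2 (hZ.inner (h.continuous_cutExt_U hφ)) P.β
    rw [h.totalIntegral_eq_zero hv hδ hχ hnec hφ, mul_zero, add_zero] at h1
    rw [← h1]
    exact h.abs_totalIntegral_le hv hχ1 hε.le hφε
  have hzero : P.totalIntegral X (fun q => ‖P.residual χ v X q‖ ^ 2) = 0 := by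
    set c := P.T * P.T * volume.real P.ω
    have hc : 0 ≤ c := by positivity
    refine abs_nonpos_iff.1 (le_of_forall_pos_le_add fun ε hε => ?_)
    refine (hsmall (ε / (c + 1)) (by positivity)).trans ?_
    rw [zero_add, div_mul_eq_mul_div, div_le_iff₀ (by positivity)]
    nlinarith
  simpa using h.eq_zero_of_totalIntegral_eq_zero hv hχ1 hZ2 (fun q => sq_nonneg _) hzero hp

end IsCutFlow

end Problem

/-! ### The Hamilton-Jacobi-Bellman equation and verification -/

namespace Problem

variable {d M : ℕ} {P : Problem d M} {v φ : ℝ → State d → ℝ}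

/-- The integral equation for the state holds in differentiated form almost everywhere. -/
theorem IsAdmissible.ae_derivWithin_eq {t₀ : ℝ} (ht₀ : t₀ ∈ Ioo 0 P.T) {y₀ : State d}
    {u : ℝ → Ctrl M} {y : ℝ → State d} (h : P.IsAdmissible t₀ y₀ u y) :
    ∀ᵐ t ∂volume.restrict (Ioo t₀ P.T),
      derivWithin y (Icc t₀ P.T) t = P.f t (y t) + P.B (u t) := by
  obtain ⟨hu, hyc, hyΩ, hy⟩ := h
  have hfc : ContinuousOn (fun t => P.f t (y t)) (Icc t₀ P.T) :=
    P.f_mem.continuousOn.comp (continuousOn_id.prodMk hyc) fun t ht =>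
      ⟨⟨ht₀.1.le.trans ht.1, ht.2⟩, hyΩ t ht⟩
  have hui : IntervalIntegrable u volume t₀ P.T := by
    rw [intervalIntegrable_iff_integrableOn_Ioo_of_le ht₀.2.le]
    exact hu.integrable one_le_two
  have hBu : IntervalIntegrable (fun t => P.B (u t)) volume t₀ P.T :=
    ⟨P.B.integrable_comp hui.1, P.B.integrable_comp hui.2⟩
  have hint := (hfc.intervalIntegrable_of_Icc ht₀.2.le).add hBu
  rw [ae_restrict_iff' measurableSet_Ioo]
  filter_upwards [hint.ae_hasDerivAt_integral] with t ht htm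
  have htI := Ioo_subset_Icc_self htm
  have h1 := ht (by rwa [uIcc_of_le ht₀.2.le]) t₀ (left_mem_uIcc)
  have h2 : HasDerivAt y (P.f t (y t) + P.B (u t)) t := by
    refine (h1.const_add y₀).congr_of_eventuallyEq ?_
    filter_upwards [Icc_mem_nhds htm.1 htm.2] with s hs using hy s hs
  rw [derivWithin_of_mem_nhds (Icc_mem_nhds htm.1 htm.2), h2.deriv]

theorem IsAdmissible.integrableOn_cost {t₀ : ℝ} (ht₀ : t₀ ∈ Ioo 0 P.T) {y₀ : State d}
    {u : ℝ → Ctrl M} {y : ℝ → State d} (h : P.IsAdmissible t₀ y₀ u y) :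
    IntegrableOn (fun t => P.ℓ t (y t) + P.β / 2 * ‖u t‖ ^ 2) (Ioo t₀ P.T) := by
  obtain ⟨hu, hyc, hyΩ, -⟩ := h
  have hlc : ContinuousOn (fun t => P.ℓ t (y t)) (Icc t₀ P.T) :=
    P.ℓ_mem.continuousOn.comp (continuousOn_id.prodMk hyc) fun t ht =>
      ⟨⟨ht₀.1.le.trans ht.1, ht.2⟩, hyΩ t ht⟩
  exact (hlc.integrableOn_Icc.mono_set Ioo_subset_Icc_self).add
    ((hu.integrable_norm_pow two_ne_zero).const_mul _)

theorem IsClosedLoop.continuousOn_comp {V : Type*} [NormedAddCommGroup V] {t₀ : ℝ} (ht₀ : 0 ≤ t₀)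
    {y₀ : State d} {K : ℝ → State d → Ctrl M} {y : ℝ → State d} (hy : P.IsClosedLoop K t₀ y₀ y)
    {k : ℝ → State d → V}
    (hk : ContinuousOn (fun p : ℝ × State d => k p.1 p.2) (Icc 0 P.T ×ˢ closure P.Ω)) :
    ContinuousOn (fun t => k t (y t)) (Icc t₀ P.T) :=
  hk.comp (continuousOn_id.prodMk hy.continuousOn) fun t ht =>
    ⟨⟨ht₀.trans ht.1, ht.2⟩, (hy.2 t ht).1⟩

theorem IsClosedLoop.eq_add_integral (hv : MemCk P.T (closure P.Ω) 2 v) {t₀ : ℝ} (ht₀ : 0 ≤ t₀)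
    {y₀ : State d} {y : ℝ → State d} (hy : P.IsClosedLoop (P.U v) t₀ y₀ y) {t : ℝ}
    (ht : t ∈ Icc t₀ P.T) : y t = y₀ + ∫ s in t₀..t, P.field v s (y s) := by
  obtain ⟨l', hl⟩ := P.exists_isC1On_field hv
  have hFc := hy.continuousOn_comp ht₀ hl.continuousOn
  have hsub : Icc t₀ t ⊆ Icc t₀ P.T := Icc_subset_Icc_right ht.2
  have := intervalIntegral.integral_eq_sub_of_hasDerivAt_of_le ht.1
    (hy.continuousOn.mono hsub) (f' := fun s => P.field v s (y s))
    (fun s hs => (hy.2 s (hsub (Ioo_subset_Icc_self hs))).2.hasDerivAt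
      (Icc_mem_nhds hs.1 (hs.2.trans_le ht.2)))
    ((hFc.mono hsub).intervalIntegrable_of_Icc ht.1)
  rw [this, hy.1]
  abel

/-- A solution of the closed-loop problem, with the control that the feedback generates, is
admissible. -/
theorem IsClosedLoop.isAdmissible (hv : MemCk P.T (closure P.Ω) 2 v) {t₀ : ℝ}
    (ht₀ : 0 ≤ t₀) {y₀ : State d} {y : ℝ → State d}
    (hy : P.IsClosedLoop (P.U v) t₀ y₀ y) :
    P.IsAdmissible t₀ y₀ (fun t => P.U v t (y t)) y := by
  obtain ⟨k', hk⟩ := P.exists_isC1On_U hv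
  have hUc := hy.continuousOn_comp ht₀ hk.continuousOn
  obtain ⟨C, hC⟩ := isCompact_Icc.exists_bound_of_continuousOn hUc
  refine ⟨?_, hy.continuousOn, fun t ht => (hy.2 t ht).1,
    fun t ht => hy.eq_add_integral hv ht₀ ht⟩
  refine MemLp.of_bound ((hUc.mono Ioo_subset_Icc_self).aestronglyMeasurable measurableSet_Ioo) C ?_
  rw [ae_restrict_iff' measurableSet_Ioo]
  exact .of_forall fun t ht => hC t (Ioo_subset_Icc_self ht)

namespace IsCutFlow

variable {χ : State d → ℝ} {X : ℝ → State d → ℝ → State d}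

theorem eq_one_of_mem_stays (h : P.IsCutFlow χ v X) {S : Set (State d)}
    (hχ : ∀ x ∈ S, χ x = 1) {p : ℝ × State d} (hp : p ∈ P.Stays X S) : χ p.2 = 1 := by
  have := hp.2 p.1 ⟨le_rfl, hp.1.2⟩
  rw [h.isFlow.init] at this
  exact hχ _ this

/-- The transport equation `∂ₜW + ∇_yW · (f + B U_v) + ℓ + β/2 |U_v|² = 0`. -/
theorem transport (h : P.IsCutFlow χ v X) {t : ℝ} (ht : t ∈ Icc 0 P.T) {y : State d}
    (hy : χ y = 1) : fderiv ℝ (P.cutValue χ v X) (t, y) (1, P.field v t y) =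
      -P.running v t y := by
  obtain ⟨F', K, hF⟩ := h.exists_isC1Bounded_field
  obtain ⟨L', K', hL⟩ := h.exists_isC1Bounded_running
  have := fderiv_value h.isFlow hF hL h.contDiff_terminal P.T t y
  rwa [cutExt_of_eq_one _ ht hy, cutExt_of_eq_one _ ht hy] at this

/-- Where the residual vanishes, `∇_yW · B u = -β U_v · u`. -/
theorem fderiv_eq_of_residual {t : ℝ} (ht : t ∈ Icc 0 P.T) {y : State d} (hy : χ y = 1)
    (hz : P.residual χ v X (t, y) = 0) (u : Ctrl M) :
    fderiv ℝ (P.cutValue χ v X) (t, y) (0, P.B u) = -(P.β * inner ℝ (P.U v t y) u) := by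
  have := P.inner_residual (v := v) χ X (t, y) u
  rw [hz, inner_zero_left, cutExt_of_eq_one _ ht hy] at this
  linarith

theorem solvesHJBOn (h : P.IsCutFlow χ v X) (hv : v ∈ P.D)
    (hχ : ∀ x ∈ closure (P.R v), χ x = 1) (hz : ∀ p ∈ P.G v, P.residual χ v X p = 0) :
    P.SolvesHJBOn (P.𝒱 v) (P.G v) := by
  have hβ := P.β_pos
  have hW := h.contDiff_cutValue
  have hGS := h.G_subset_stays hv hχ
  have hGo := h.isOpen_G hv hχ
  have heq : ∀ p ∈ P.G v, P.𝒱 v p.1 p.2 = P.cutValue χ v X p := fun p hp =>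
    h.𝒱_eq_of_mem_stays hχ (hGS hp)
  refine ⟨hW.contDiffOn.congr heq, fun t y hp => ?_⟩
  have ht := (hGS hp).1
  have hy : χ y = 1 := h.eq_one_of_mem_stays hχ (hGS hp)
  have hD := ((hW.differentiable one_ne_zero) (t, y)).hasFDerivAt
  have hspace : HasFDerivAt (P.𝒱 v t) ((fderiv ℝ (P.cutValue χ v X) (t, y)).comp
      (ContinuousLinearMap.inr ℝ ℝ (State d))) y := by
    refine (hD.comp y (hasFDerivAt_prodMk_right t y)).congr_of_eventuallyEq ?_
    filter_upwards [(Continuous.prodMk_right t).continuousAt.eventually (hGo.mem_nhds hp)]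
      with z hz' using heq _ hz'
  have htime : HasDerivAt (fun s => P.𝒱 v s y) (fderiv ℝ (P.cutValue χ v X) (t, y) (1, 0)) t := by
    have h1 : HasDerivAt (fun s => (s, y)) ((1, 0) : ℝ × State d) t :=
      (hasDerivAt_id t).prodMk (hasDerivAt_const t y)
    refine (hD.comp_hasDerivAt t h1).congr_of_eventuallyEq ?_
    filter_upwards [(Continuous.prodMk_left y).continuousAt.eventually (hGo.mem_nhds hp)]
      with s hs using heq _ hs
  have hgrad : ∀ x, inner ℝ (gradient (P.𝒱 v t) y) x =
      fderiv ℝ (P.cutValue χ v X) (t, y) (0, x) := fun x => by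
    rw [gradient_eq_riesz, hspace.fderiv, inner_riesz]
    simp
  have hsplit : ∀ u, inner ℝ (gradient (P.𝒱 v t) y) (P.f t y + P.B u) =
      fderiv ℝ (P.cutValue χ v X) (t, y) (0, P.f t y) - P.β * inner ℝ (P.U v t y) u := fun u => by
    rw [inner_add_right, hgrad, hgrad, fderiv_eq_of_residual ht hy (hz _ hp), sub_eq_add_neg]
  refine ⟨inner ℝ (gradient (P.𝒱 v t) y) (P.f t y + P.B (P.U v t y)) +
    P.β / 2 * ‖P.U v t y‖ ^ 2, ⟨⟨P.U v t y, rfl⟩, ?_⟩, ?_⟩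
  · rintro _ ⟨u, rfl⟩
    simp only [hsplit, real_inner_self_eq_norm_sq]
    -- completing the square
    have h1 := norm_sub_sq_real u (P.U v t y)
    rw [real_inner_comm] at h1
    nlinarith [mul_nonneg hβ.le (sq_nonneg ‖u - P.U v t y‖)]
  · have htr := h.transport ht hy
    have e : ((1, P.field v t y) : ℝ × State d) = (1, 0) + (0, P.field v t y) := by simp
    rw [e, map_add, running] at htr
    rw [htime.deriv, hgrad]
    change _ + _ + (fderiv ℝ (P.cutValue χ v X) (t, y) (0, P.field v t y) + _) = 0
    linarith

/-- Verification: no trajectory in `𝒢(v)` has a cost below `W(t₀,y₀)`. -/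
theorem cutValue_le_cost (h : P.IsCutFlow χ v X) (hv : v ∈ P.D)
    (hχ : ∀ x ∈ closure (P.R v), χ x = 1) (hz : ∀ p ∈ P.G v, P.residual χ v X p = 0)
    {t₀ : ℝ} (ht₀ : t₀ ∈ Ioo 0 P.T) {y₀ : State d} {u : ℝ → Ctrl M} {y : ℝ → State d}
    (hu : P.IsAdmissible t₀ y₀ u y) (hy : ContDiffOn ℝ 1 y (Icc t₀ P.T))
    (hG : ∀ t ∈ Ico t₀ P.T, (t, y t) ∈ P.G v) :
    P.cutValue χ v X (t₀, y₀) ≤ P.cost t₀ u y := by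
  obtain ⟨F', K, hF⟩ := h.exists_isC1Bounded_field
  obtain ⟨L', K', hL⟩ := h.exists_isC1Bounded_running
  have hβ := P.β_pos
  have hT : P.T ∈ Icc t₀ P.T := ⟨ht₀.2.le, le_rfl⟩
  have hW := h.contDiff_cutValue
  have hGS := h.G_subset_stays hv hχ
  have hyc := hu.2.1
  have hy0 : y t₀ = y₀ := by
    have := hu.2.2.2 t₀ ⟨le_rfl, ht₀.2.le⟩
    simpa using this
  have hχy : ∀ t ∈ Ico t₀ P.T, χ (y t) = 1 := fun t ht =>
    h.eq_one_of_mem_stays hχ (hGS (hG t ht))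
  -- `𝒢(v)` has no points at the final time; there, `y` is a limit of states in the reached set
  have hχT : χ (y P.T) = 1 := by
    have hmaps : MapsTo y (Ico t₀ P.T) {x | χ x = 1} := hχy
    have hcl := hmaps.closure_of_continuousOn (by rwa [closure_Ico ht₀.2.ne])
    rw [closure_Ico ht₀.2.ne] at hcl
    have hclosed : IsClosed {x | χ x = 1} := isClosed_eq h.contDiff.continuous continuous_const
    have := hcl hT
    rwa [hclosed.closure_eq] at this
  have hu' : UniqueDiffOn ℝ (Icc t₀ P.T) := uniqueDiffOn_Icc ht₀.2
  have hy'c : ContinuousOn (derivWithin y (Icc t₀ P.T)) (Icc t₀ P.T) :=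
    hy.continuousOn_derivWithin hu' le_rfl
  have hcost := integral_add_eq_value_add h.isFlow hF hL h.contDiff_terminal ht₀.2.le hyc
    (fun t ht => ((hy.differentiableOn one_ne_zero t
      (Ioo_subset_Icc_self ht)).hasDerivWithinAt).hasDerivAt (Icc_mem_nhds ht.1 ht.2)) hy'c
  have hty : ContinuousOn (fun t => (t, y t)) (Icc t₀ P.T) := continuousOn_id.prodMk hyc
  have hcL : ContinuousOn (fun t => cutExt P.T χ (P.running v) t (y t)) (Icc t₀ P.T) :=
    hL.continuous.comp_continuousOn hty
  have hcF : ContinuousOn (fun t => cutExt P.T χ (P.field v) t (y t)) (Icc t₀ P.T) :=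
    hF.continuous.comp_continuousOn hty
  have hcD : ContinuousOn (fun t => fderiv ℝ (P.cutValue χ v X) (t, y t)
      (0, derivWithin y (Icc t₀ P.T) t - cutExt P.T χ (P.field v) t (y t))) (Icc t₀ P.T) :=
    ((hW.continuous_fderiv one_ne_zero).comp_continuousOn hty).clm_apply
      (continuousOn_const.prodMk (hy'c.sub hcF))
  rw [hy0, cutExt_of_eq_one _ ⟨le_rfl, P.T_pos.le⟩ hχT] at hcost
  change _ = P.cutValue χ v X (t₀, y₀) + ∫ t in t₀..P.T, fderiv ℝ (P.cutValue χ v X) (t, y t)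
      (0, derivWithin y (Icc t₀ P.T) t - cutExt P.T χ (P.field v) t (y t)) at hcost
  have hsub := intervalIntegral.integral_sub (hcL.intervalIntegrable_of_Icc ht₀.2.le)
    (hcD.intervalIntegrable_of_Icc (μ := volume) ht₀.2.le)
  have hle : (∫ t in t₀..P.T, (cutExt P.T χ (P.running v) t (y t) -
      fderiv ℝ (P.cutValue χ v X) (t, y t)
        (0, derivWithin y (Icc t₀ P.T) t - cutExt P.T χ (P.field v) t (y t)))) ≤
      ∫ t in t₀..P.T, (P.ℓ t (y t) + P.β / 2 * ‖u t‖ ^ 2) := by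
    rw [intervalIntegral.integral_of_le ht₀.2.le, intervalIntegral.integral_of_le ht₀.2.le,
      integral_Ioc_eq_integral_Ioo, integral_Ioc_eq_integral_Ioo]
    refine integral_mono_ae (((hcL.sub hcD).integrableOn_Icc).mono_set Ioo_subset_Icc_self)
      (hu.integrableOn_cost ht₀) ?_
    filter_upwards [hu.ae_derivWithin_eq ht₀, ae_restrict_mem measurableSet_Ioo] with t hder ht
    have htT : t ∈ Icc 0 P.T := ⟨ht₀.1.le.trans ht.1.le, ht.2.le⟩
    have htG := hG t (Ioo_subset_Ico_self ht)
    have hone := hχy t (Ioo_subset_Ico_self ht)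
    have e : P.f t (y t) + P.B (u t) - P.field v t (y t) = P.B (u t - P.U v t (y t)) := by
      rw [field, map_sub]; abel
    rw [hder, cutExt_of_eq_one _ htT hone, cutExt_of_eq_one _ htT hone, e,
      fderiv_eq_of_residual htT hone (hz _ htG), running, inner_sub_right,
      real_inner_self_eq_norm_sq]
    have h1 := norm_sub_sq_real (u t) (P.U v t (y t))
    rw [real_inner_comm] at h1
    nlinarith [mul_nonneg hβ.le (sq_nonneg ‖u t - P.U v t (y t)‖)]
  rw [hsub] at hle
  rw [cost]
  linarith

end IsCutFlow

end Problem

end FeedbackLearning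

theorem mainTheorem2 {d M : ℕ} (P : FeedbackLearning.Problem d M)
    (v : ℝ → FeedbackLearning.State d → ℝ) (hv : v ∈ P.D) (hnec : P.NecessaryCondition v) :
    -- the HJB equation in the open set `𝒢(v)`
    IsOpen (P.G v) ∧ P.SolvesHJBOn (P.𝒱 v) (P.G v) ∧
    -- the terminal condition, attained continuously
    ContinuousOn (fun p : ℝ × FeedbackLearning.State d => P.𝒱 v p.1 p.2) (closure (P.G v)) ∧
    (∀ y₀ : FeedbackLearning.State d, (P.T, y₀) ∈ closure (P.G v) → P.𝒱 v P.T y₀ = P.g y₀) ∧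
    -- optimality of the feedback
    ∀ (t₀ : ℝ) (y₀ : FeedbackLearning.State d), (t₀, y₀) ∈ P.G v →
      (∃ (u : ℝ → FeedbackLearning.Ctrl M) (y : ℝ → FeedbackLearning.State d),
        P.IsOptimal t₀ y₀ u y ∧ ContDiffOn ℝ 1 y (Set.Icc t₀ P.T) ∧
        ∀ t ∈ Set.Ico t₀ P.T, (t, y t) ∈ P.G v) →
      P.IsOptimalFeedbackAt (P.U v) t₀ y₀ := by
  obtain ⟨χ, h1, h2, h3, δ, hδ, hχ⟩ := FeedbackLearning.exists_cutoff (P.isCompact_closure_R hv)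
    P.isOpen_Ω hv.2.2
  obtain ⟨X, h⟩ := P.exists_isCutFlow hv.1 h1 h2 h3
  have hχ1 : ∀ x ∈ closure (P.R v), χ x = 1 := fun x hx => hχ x hx x (by simpa using hδ)
  have hz : ∀ p ∈ P.G v, P.residual χ v X p = 0 := fun p hp =>
    h.residual_eq_zero hv hδ hχ hnec hp
  have hcl := h.closure_G_subset_stays hv hχ1
  refine ⟨h.isOpen_G hv hχ1, h.solvesHJBOn hv hχ1 hz, ?_, fun y₀ hy₀ => ?_, ?_⟩
  · exact h.contDiff_cutValue.continuous.continuousOn.congr fun p hp =>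
      h.𝒱_eq_of_mem_stays hχ1 (hcl hp)
  · have hS := hcl hy₀
    have e1 := h.𝒱_eq_of_mem_stays hχ1 hS
    have e2 : P.cutValue χ v X (P.T, y₀) = FeedbackLearning.cutExt P.T χ (fun _ => P.g) 0 y₀ :=
      FeedbackLearning.value_terminal h.isFlow P.T y₀
    rw [FeedbackLearning.cutExt_of_eq_one _ ⟨le_rfl, P.T_pos.le⟩
      (h.eq_one_of_mem_stays hχ1 hS)] at e2
    exact e1.trans e2
  · rintro t₀ y₀ hG ⟨u, y, hopt, hy, hyG⟩
    have hS := h.G_subset_stays hv hχ1 hG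
    have ht₀ : t₀ ∈ Set.Ioo 0 P.T := by
      obtain ⟨s, hs, -, -, ht, -⟩ := (h.mem_G_iff hv hχ1).1 hG
      exact ⟨hs.1.trans_le ht.1, ht.2⟩
    have hone : ∀ t ∈ Set.Icc t₀ P.T, χ (X t₀ y₀ t) = 1 := fun t ht => hχ1 _ (hS.2 t ht)
    have hX := h.isClosedLoop ht₀.1.le hone
    refine ⟨⟨_, hX⟩, fun z hzc => ⟨hzc.isAdmissible hv.1 ht₀.1.le, fun u' y' h' => ?_⟩⟩
    have hcost : P.cost t₀ (fun t => P.U v t (z t)) z = P.cutValue χ v X (t₀, y₀) :=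
      P.cost_eq_cutValue hS.1 hone (P.closedLoop_unique hv.1 ht₀.1.le hzc hX)
    rw [hcost]
    exact (h.cutValue_le_cost hv hχ1 hz ht₀ hopt.1 hy hyG).trans (hopt.2 u' y' h')
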